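/- **Theorem (Application of AAE to fast-square-rootable operators).** Let $A=\sum_{j=0}^{J-1}A_j$, $A_j=\sum_{k=1}^{n_j}\beta_{jk}\Pi_{jk}$ with $J\ge 1$, be an operator on $\mathbb C^d$, where the $\Pi_{jk}$ are orthogonal projectors and, for each $j$, the real numbers $\beta_{jk}$ are all non-negative or all non-positive, and not all zero. Put $\|\beta\|_{1,1/2}:=\sum_j\bigl(\sum_k\sqrt{|\beta_{jk}|}\bigr)^2$, $R_{jk}:=\mathbb 1-2\Pi_{jk}$, and let $\mu_j\ge 1$ be integers and $$P_0(j):=\sin^2\!\Bigl(\frac{\pi}{2(2\mu_j+1)}\Bigr).$$ An algorithm may query (as black boxes, at unit cost, each also in its inverse) a unitary $O_\psi$ with $O_\psi|0\rangle=|\psi\rangle$ and, for every $j$, unitaries $\mathtt{SELECT}_\pi$ and $\mathtt{PREPARE}_\pi$ such that $$\mathtt{SELECT}_\pi|k\rangle|y\rangle|v\rangle|\varphi\rangle=|k\rangle\, Z|y\rangle\,\bigl(R_{jk}^y\otimes(|0\rangle\langle k|+|k\rangle\langle 0|)\bigr)|v\rangle|\varphi\rangle \quad (1\le k\le n_j,\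 y\in\{0,1\},\ \varphi\in\{0,k\}),$$ $$\mathtt{PREPARE}_\pi|0\rangle|0\rangle=\sum_{k=1}^{n_j}\sum_{y\in\{0,1\}}\frac{|\beta_{jk}|^{1/4}}{\sqrt2\,\sqrt{\sum_{k}\sqrt{|\beta_{jk}|}}}\,|k\rangle|y\rangle .$$ For all constants $C>0$ and $\delta_0<1$ there is a constant $K>0$, depending only on $C$ and $\delta_0$, such that for all $d\ge1$, $J$, $n_j$, $\beta_{jk}$, $\mu_j$ as above, all $\epsilon>0$ and all $0<\delta'\le\delta_0$ there is a quantum query algorithm, which depends only on these data, with the following property. For all projectors $\Pi_{jk}$, all states $|\psi\rangle$ and all such oracles, if the numbers $\delta_j$ defined by $$\frac{|\langle\psi|A_j|\psi\rangle|}{\bigl(\sum_k\sqrt{|\beta_{jk}|}\bigr)^2}=P_0(j)+\delta_j$$ satisfy $\delta_j\in[-P_0(j),0)$ for every $j$, and if $\epsilon\le C\,\|\beta\|_{1,1/2}\,\min_j P_0(j)^2/|\delta_j|$, then the algorithm outputs an estimate of $\langle\psi|A|\psi\rangle$ that has error at most $\epsilon$, except with probability at most $\delta'$, and its total number of queries to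 $\mathtt{SELECT}_\pi$, $\mathtt{PREPARE}_\pi$, $O_\psi$ and their inverses is at most $$K\,\frac{\bigl(\sum_j\sqrt{P_0(j)}\bigr)\,\|\beta\|_{1,1/2}\,\log(J/\delta')}{\epsilon}\,\max_j\frac{P_0(j)}{|\delta_j|}.$$ -/

import Mathlib

open scoped Matrix Kronecker

namespace AAE

noncomputable section

/-- The computational basis vector with label `i`. -/
def ket {ι : Type} [DecidableEq ι] (i : ι) : ι → ℂ := Pi.single i 1

/-- The expectation value of a Hermitian matrix `M` in the state `ψ` (the imaginary part of
`ψᴴ M ψ` vanishes when `M` is Hermitian). -/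
def expVal {d : ℕ} (ψ : Fin d → ℂ) (M : Matrix (Fin d) (Fin d) ℂ) : ℝ :=
  (star ψ ⬝ᵥ (M *ᵥ ψ)).re

/-- The basis of the registers of the select oracle of a group with `m` projectors: the index
register `k ∈ {0, …, m}`, the qubit `y`, the system register, and the register `φ`, which is a copy
of the index register. The projectors are labelled by `k = 1, …, m`. -/
abbrev SelectIdx (d m : ℕ) : Type := Fin (m + 1) × Fin 2 × Fin d × Fin (m + 1)

/-- The basis of the registers of the prepare oracle: the index register and the qubit `y`. -/
abbrev PrepareIdx (m : ℕ) : Type := Fin (m + 1) × Fin 2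

/-- The product vector `u ⊗ y ⊗ v ⊗ w` on the registers of the select oracle. -/
def tensor4 {d m : ℕ} (u : Fin (m + 1) → ℂ) (y : Fin 2 → ℂ) (v : Fin d → ℂ)
    (w : Fin (m + 1) → ℂ) : SelectIdx d m → ℂ :=
  fun x => u x.1 * y x.2.1 * v x.2.2.1 * w x.2.2.2

/-- The product vector `u ⊗ y` on the registers of the prepare oracle. -/
def tensor2 {m : ℕ} (u : Fin (m + 1) → ℂ) (y : Fin 2 → ℂ) : PrepareIdx m → ℂ :=
  fun x => u x.1 * y x.2

/-- The Pauli matrix `Z`. -/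
def pauliZ : Matrix (Fin 2) (Fin 2) ℂ := !![1, 0; 0, -1]

/-- The matrix `|0⟩⟨k| + |k⟩⟨0|`. -/
def flip0 {m : ℕ} (k : Fin (m + 1)) : Matrix (Fin (m + 1)) (Fin (m + 1)) ℂ :=
  Matrix.single 0 k 1 + Matrix.single k 0 1

/-- The number `∑ₖ √|bₖ|` of a group with coefficients `b`. -/
def sqrtSum {m : ℕ} (b : Fin m → ℝ) : ℝ := ∑ k, √|b k|

/-- The unitaries behind the oracles: one state preparation, and one select and one prepare
oracle for each group `j`. The group `j` has `n j` projectors. -/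
structure Oracles (d : ℕ) {J : ℕ} (n : Fin J → ℕ) where
  state : Matrix.unitaryGroup (Fin d) ℂ
  select : ∀ j, Matrix.unitaryGroup (SelectIdx d (n j)) ℂ
  prepare : ∀ j, Matrix.unitaryGroup (PrepareIdx (n j)) ℂ

/-- The oracles give access to the state `ψ`, to the projectors `P j k` (through the reflections
`1 - 2 * P j k`) and to the coefficients `β j k`. Nothing is required of the action of the
oracles on other inputs, except that they are unitary. The formula for the select oracle is imposed
for `φ = |0⟩` and `φ = |k⟩`; `|0⟩⟨k| + |k⟩⟨0|` kills the other basis vectors, so that no unitary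
could satisfy it there. -/
structure Oracles.Encodes {d : ℕ} [NeZero d] {J : ℕ} {n : Fin J → ℕ} (O : Oracles d n)
    (ψ : Fin d → ℂ) (β : ∀ j, Fin (n j) → ℝ)
    (P : ∀ j, Fin (n j) → Matrix (Fin d) (Fin d) ℂ) : Prop where
  state_zero : O.state.1 *ᵥ ket 0 = ψ
  select_apply : ∀ (j : Fin J) (k : Fin (n j)) (y : Fin 2) (v : Fin d → ℂ) (f : Fin (n j + 1)),
    f = 0 ∨ f = k.succ →
      (O.select j).1 *ᵥ tensor4 (ket k.succ) (ket y) v (ket f) =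
        tensor4 (ket k.succ) (pauliZ *ᵥ ket y) (((1 - (2 : ℂ) • P j k) ^ (y : ℕ)) *ᵥ v)
          (flip0 k.succ *ᵥ ket f)
  prepare_zero : ∀ j : Fin J,
    (O.prepare j).1 *ᵥ tensor2 (ket 0) (ket 0) =
      ∑ k : Fin (n j), ∑ y : Fin 2,
        ((|β j k| ^ (1 / 4 : ℝ) / (√2 * √(sqrtSum (β j))) : ℝ) : ℂ) •
          tensor2 (ket k.succ) (ket y)

/-- The matrix that applies `U` to the first factor of a workspace with basis `Ω`, split by `e`
as a register with basis `ι` and a remainder with basis `R`. -/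
def onRegister {Ω ι R : Type} [DecidableEq R] (e : Ω ≃ ι × R) (U : Matrix ι ι ℂ) :
    Matrix Ω Ω ℂ :=
  (U ⊗ₖ (1 : Matrix R R ℂ)).submatrix e e

/-- One step of a query algorithm with workspace basis `Ω`: a gate, which is a fixed unitary that
does not depend on the oracles, or one query to one of the oracles or (for `inv = true`) to
its inverse, on a register of the workspace. -/
inductive Step (d : ℕ) {J : ℕ} (n : Fin J → ℕ) (Ω : Type) [Fintype Ω] [DecidableEq Ω] : Type 1
  | gate (V : Matrix.unitaryGroup Ω ℂ)
  | queryState (inv : Bool) (R : Type) [Fintype R] [DecidableEq R] (e : Ω ≃ Fin d × R)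
  | querySelect (j : Fin J) (inv : Bool) (R : Type) [Fintype R] [DecidableEq R]
      (e : Ω ≃ SelectIdx d (n j) × R)
  | queryPrepare (j : Fin J) (inv : Bool) (R : Type) [Fintype R] [DecidableEq R]
      (e : Ω ≃ PrepareIdx (n j) × R)

/-- `U` or its inverse. -/
def orInv {ι : Type} (inv : Bool) (U : Matrix ι ι ℂ) : Matrix ι ι ℂ := if inv then Uᴴ else U

/-- The matrix by which a step acts on the workspace. -/
def Step.matrix {d J : ℕ} {n : Fin J → ℕ} {Ω : Type} [Fintype Ω] [DecidableEq Ω]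
    (O : Oracles d n) : Step d n Ω → Matrix Ω Ω ℂ
  | .gate V => V.1
  | @Step.queryState _ _ _ _ _ _ inv _ _ _ e => onRegister e (orInv inv O.state.1)
  | @Step.querySelect _ _ _ _ _ _ j inv _ _ _ e => onRegister e (orInv inv (O.select j).1)
  | @Step.queryPrepare _ _ _ _ _ _ j inv _ _ _ e => onRegister e (orInv inv (O.prepare j).1)

/-- The number of queries (zero or one) that a step makes. -/
def Step.cost {d J : ℕ} {n : Fin J → ℕ} {Ω : Type} [Fintype Ω] [DecidableEq Ω] :
    Step d n Ω → ℕ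
  | .gate _ => 0
  | @Step.queryState .. => 1
  | @Step.querySelect .. => 1
  | @Step.queryPrepare .. => 1

/-- A quantum query algorithm with a real output: a finite workspace that starts in a basis state,
a list of steps (intermediate measurements are deferred to the end), a measurement of the
workspace in the computational basis, and a function that turns the outcome into the output. -/
structure QueryAlgorithm (d : ℕ) {J : ℕ} (n : Fin J → ℕ) : Type 1 where
  Ω : Type
  [fintypeΩ : Fintype Ω]
  [decEqΩ : DecidableEq Ω]
  start : Ω
  steps : List (Step d n Ω)
  output : Ω → ℝ

attribute [instance] QueryAlgorithm.fintypeΩ QueryAlgorithm.decEqΩ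

namespace QueryAlgorithm

variable {d J : ℕ} {n : Fin J → ℕ}

/-- The state of the workspace before the measurement. -/
def finalState (alg : QueryAlgorithm d n) (O : Oracles d n) : alg.Ω → ℂ :=
  alg.steps.foldl (fun v s => s.matrix O *ᵥ v) (ket alg.start)

/-- The total number of queries to all oracles and their inverses. -/
def queries (alg : QueryAlgorithm d n) : ℕ := (alg.steps.map Step.cost).sum

open Classical in
/-- The probability (Born rule) that the output differs from `a` by more than `ε`. -/
def failureProb (alg : QueryAlgorithm d n) (O : Oracles d n) (a ε : ℝ) : ℝ :=
  ∑ x with ε < |alg.output x - a|, ‖alg.finalState O x‖ ^ 2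

end QueryAlgorithm

/-- The operator `A_j = ∑ₖ β_{jk} Π_{jk}` of the group `j`. -/
def groupOp {d J : ℕ} {n : Fin J → ℕ} (β : ∀ j, Fin (n j) → ℝ)
    (P : ∀ j, Fin (n j) → Matrix (Fin d) (Fin d) ℂ) (j : Fin J) : Matrix (Fin d) (Fin d) ℂ :=
  ∑ k, (β j k : ℂ) • P j k

/-- The norm `‖β‖_{1,1/2} = ∑ⱼ (∑ₖ √|β_{jk}|)²`. -/
def normOneHalf {J : ℕ} {n : Fin J → ℕ} (β : ∀ j, Fin (n j) → ℝ) : ℝ :=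
  ∑ j, sqrtSum (β j) ^ 2

/-- The upper bound `P₀ = sin² (π / (2 (2μ + 1)))`. -/
def upperBound (μ : ℕ) : ℝ := Real.sin (Real.pi / (2 * (2 * μ + 1))) ^ 2

end

end AAE

/-!
Write `S_j` for `sqrtSum (β j)` and `p_j` for `|⟨ψ|A_j|ψ⟩| / S_j ^ 2`. The number `p_j` is the
probability that the unitary `V = PREPARE⁻¹ SELECT PREPARE O_ψ`, applied to the initial basis state,
yields the outcome `(0, 0)` on the registers of the prepare oracle: the projection onto
`PREPARE |0, 0⟩` turns `|0⟩ ψ - |1⟩ R_{jk} ψ` into a multiple of `(1 - R_{jk}) ψ = 2 Π_{jk} ψ`, and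
the copy of the index in the register `φ` makes the contributions of different `k` orthogonal
(`goodProb_groupUnitary`). The signs of the groups are known, so that `⟨ψ|A|ψ⟩` is the sum of the
`± S_j ^ 2 * p_j`, and it suffices to estimate every `p_j` to a precision `η ≤ ε / ‖β‖_{1,1/2}`.

The promise `δ_j < 0` gives `p_j ≤ P₀(j)`, and amplitude estimation with `K` Grover iterations then
has an error of order `√P₀(j) / K + 1 / K ^ 2`, so that `K` of order `√P₀(j) / η` suffices as long
as `η ≤ P₀(j)`. The precision `η` is therefore the minimum of `ε / ‖β‖_{1,1/2}` and
`C * min_j P₀(j)`, up to a constant factor. If the second term is the smaller one, the hypothesis on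
`ε` bounds `|δ_j|` from above, and the factor `max_j P₀(j) / |δ_j|` pays for the higher
precision (`inv_min_le`).

Amplitude estimation needs neither the quantum Fourier transform nor a decomposition into
eigenspaces of the Grover iterate `Q`. The vectors `Q ^ t V |a⟩` satisfy the three term recurrence
of the Chebyshev polynomials with parameter `m = 1 - 2 p` (`groverVec_recurrence`), and the sine window
`c_t` satisfies the same recurrence with parameter `cos (π / (K + 2))` (`exists_window`). It
follows that the superposition of the `c_t |t⟩ Q ^ t V |a⟩` is an approximate eigenvector, for the
eigenvalue `m`, of half the adjacency matrix of a path, acting on the time register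
(`sum_window_deviation_le`). The measurement of that Hermitian matrix in an eigenbasis thus yields
`m` with small mean square error (`exists_amplitudeEstimation`). Only the reflections in `Q` have to
be controlled by the time register, hence no controlled queries are needed.

A failure probability of `1 / 16` for a single run follows from Chebyshev's inequality. Majority
votes among `O (log (J / δ'))` independent runs, performed on separate parts of a product
workspace, and a union bound over the groups give the failure probability `δ'`
(`exists_linearCombination_estimate`).
-/

namespace AAE

noncomputable section

/-! ### Registers of a workspace -/

section Register

variable {Ω ι R : Type} [Fintype Ω] [Fintype ι] [Fintype R] [DecidableEq Ω] [DecidableEq ι]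
  [DecidableEq R]

omit [Fintype ι] [Fintype R] [DecidableEq Ω] [DecidableEq ι] [DecidableEq R] in
theorem dotProduct_star_self (v : Ω → ℂ) : star v ⬝ᵥ v = ((∑ x, ‖v x‖ ^ 2 : ℝ) : ℂ) := by
  simp [dotProduct, RCLike.conj_mul]

theorem sum_norm_sq_mulVec {U : Matrix Ω Ω ℂ} (hU : U ∈ Matrix.unitaryGroup Ω ℂ) (v : Ω → ℂ) :
    ∑ x, ‖(U *ᵥ v) x‖ ^ 2 = ∑ x, ‖v x‖ ^ 2 := by
  have h : star (U *ᵥ v) ⬝ᵥ (U *ᵥ v) = star v ⬝ᵥ v := by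
    rw [Matrix.star_mulVec, Matrix.dotProduct_mulVec, Matrix.vecMul_vecMul,
      ← Matrix.star_eq_conjTranspose, Matrix.mem_unitaryGroup_iff'.1 hU, Matrix.vecMul_one]
  rw [dotProduct_star_self, dotProduct_star_self] at h
  exact_mod_cast h

omit [DecidableEq Ω] [DecidableEq ι] in
theorem onRegister_mulVec (e : Ω ≃ ι × R) (U : Matrix ι ι ℂ) (v : Ω → ℂ) (x : Ω) :
    (onRegister e U *ᵥ v) x = (U *ᵥ fun i => v (e.symm (i, (e x).2))) (e x).1 := by
  simp only [Matrix.mulVec, dotProduct, onRegister, Matrix.submatrix_apply]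
  rw [← e.symm.sum_comp, Fintype.sum_prod_type]
  simp [Matrix.kroneckerMap_apply, Matrix.one_apply]

omit [Fintype Ω] [Fintype ι] [Fintype R] [DecidableEq Ω] [DecidableEq ι] in
theorem onRegister_conjTranspose (e : Ω ≃ ι × R) (U : Matrix ι ι ℂ) :
    (onRegister e U)ᴴ = onRegister e Uᴴ := by
  simp [onRegister, Matrix.conjTranspose_kronecker]

omit [DecidableEq Ω] [DecidableEq ι] in
theorem onRegister_mul (e : Ω ≃ ι × R) (U V : Matrix ι ι ℂ) :
    onRegister e U * onRegister e V = onRegister e (U * V) := by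
  simp [onRegister, ← Matrix.mul_kronecker_mul, Matrix.submatrix_mul_equiv]

omit [Fintype Ω] [Fintype ι] [Fintype R] in
theorem onRegister_one (e : Ω ≃ ι × R) : onRegister e (1 : Matrix ι ι ℂ) = 1 := by
  simp [onRegister]

theorem onRegister_mem_unitaryGroup (e : Ω ≃ ι × R) {U : Matrix ι ι ℂ}
    (hU : U ∈ Matrix.unitaryGroup ι ℂ) : onRegister e U ∈ Matrix.unitaryGroup Ω ℂ := by
  rw [Matrix.mem_unitaryGroup_iff, Matrix.star_eq_conjTranspose, onRegister_conjTranspose,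
    onRegister_mul, ← Matrix.star_eq_conjTranspose, Matrix.mem_unitaryGroup_iff.1 hU,
    onRegister_one]

/-- A register of a register is a register of the whole workspace. -/
def subRegister {Ω Ω' ι R S : Type} (e : Ω' ≃ Ω × S) (f : Ω ≃ ι × R) : Ω' ≃ ι × (R × S) :=
  e.trans ((f.prodCongr (Equiv.refl S)).trans (Equiv.prodAssoc ι R S))

omit [Fintype Ω] [Fintype ι] [Fintype R] [DecidableEq Ω] [DecidableEq ι] in
theorem onRegister_subRegister {Ω' S : Type} [DecidableEq S] (e : Ω' ≃ Ω × S) (f : Ω ≃ ι × R)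
    (U : Matrix ι ι ℂ) : onRegister (subRegister e f) U = onRegister e (onRegister f U) := by
  ext x y
  simp only [onRegister, subRegister, Matrix.submatrix_apply, Matrix.kroneckerMap_apply,
    Matrix.one_apply, Equiv.trans_apply, Equiv.prodCongr_apply, Equiv.prodAssoc_apply, Prod.map,
    Equiv.refl_apply, Prod.mk.injEq, ite_and]
  split_ifs <;> simp

end Register

/-! ### Running lists of steps -/

section Run

variable {d J : ℕ} {n : Fin J → ℕ} {Ω : Type} [Fintype Ω] [DecidableEq Ω]

/-- The effect of a list of steps on a vector of the workspace. -/
def run (O : Oracles d n) (l : List (Step d n Ω)) (v : Ω → ℂ) : Ω → ℂ :=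
  l.foldl (fun v s => s.matrix O *ᵥ v) v

@[simp] theorem run_nil (O : Oracles d n) (v : Ω → ℂ) : run O ([] : List (Step d n Ω)) v = v := rfl

@[simp] theorem run_cons (O : Oracles d n) (s : Step d n Ω) (l : List (Step d n Ω)) (v : Ω → ℂ) :
    run O (s :: l) v = run O l (s.matrix O *ᵥ v) := rfl

theorem run_append (O : Oracles d n) (l l' : List (Step d n Ω)) (v : Ω → ℂ) :
    run O (l ++ l') v = run O l' (run O l v) := List.foldl_append

theorem orInv_true {ι : Type} (U : Matrix ι ι ℂ) : orInv true U = Uᴴ := rfl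

theorem orInv_false {ι : Type} (U : Matrix ι ι ℂ) : orInv false U = U := rfl

theorem Step.queryState_matrix {R : Type} [Fintype R] [DecidableEq R] (O : Oracles d n)
    (inv : Bool) (e : Ω ≃ Fin d × R) :
    (Step.queryState (n := n) inv R e).matrix O = onRegister e (orInv inv O.state.1) := rfl

theorem Step.querySelect_matrix {R : Type} [Fintype R] [DecidableEq R] (O : Oracles d n)
    (j : Fin J) (inv : Bool) (e : Ω ≃ SelectIdx d (n j) × R) :
    (Step.querySelect j inv R e).matrix O = onRegister e (orInv inv (O.select j).1) := rfl

theorem Step.queryPrepare_matrix {R : Type} [Fintype R] [DecidableEq R] (O : Oracles d n)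
    (j : Fin J) (inv : Bool) (e : Ω ≃ PrepareIdx (n j) × R) :
    (Step.queryPrepare j inv R e).matrix O = onRegister e (orInv inv (O.prepare j).1) := rfl

theorem orInv_mem_unitaryGroup {ι : Type} [Fintype ι] [DecidableEq ι] (inv : Bool)
    {U : Matrix ι ι ℂ} (hU : U ∈ Matrix.unitaryGroup ι ℂ) :
    orInv inv U ∈ Matrix.unitaryGroup ι ℂ := by
  cases inv
  · simpa [orInv] using hU
  · simpa [orInv, ← Matrix.star_eq_conjTranspose] using Unitary.star_mem hU

theorem Step.matrix_mem_unitaryGroup (O : Oracles d n) (s : Step d n Ω) :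
    s.matrix O ∈ Matrix.unitaryGroup Ω ℂ := by
  have hR : ∀ {ι R : Type} [Fintype ι] [Fintype R] [DecidableEq ι] [DecidableEq R]
      (e : Ω ≃ ι × R) (U : Matrix.unitaryGroup ι ℂ) (inv : Bool),
      onRegister e (orInv inv U.1) ∈ Matrix.unitaryGroup Ω ℂ :=
    fun e U inv => onRegister_mem_unitaryGroup e (orInv_mem_unitaryGroup inv U.2)
  cases s with
  | gate V => exact V.2
  | queryState inv R e => exact hR e _ inv
  | querySelect j inv R e => exact hR e _ inv
  | queryPrepare j inv R e => exact hR e _ inv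

theorem sum_norm_sq_run (O : Oracles d n) (l : List (Step d n Ω)) (v : Ω → ℂ) :
    ∑ x, ‖run O l v x‖ ^ 2 = ∑ x, ‖v x‖ ^ 2 := by
  induction l generalizing v with
  | nil => rfl
  | cons s l ih => rw [run_cons, ih, sum_norm_sq_mulVec (s.matrix_mem_unitaryGroup O)]

/-- The step of a workspace `Ω'` that performs a given step on a part `Ω` of it. -/
def Step.lift {Ω' S : Type} [Fintype Ω'] [DecidableEq Ω'] [Fintype S] [DecidableEq S]
    (e : Ω' ≃ Ω × S) : Step d n Ω → Step d n Ω'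
  | .gate V => .gate ⟨onRegister e V.1, onRegister_mem_unitaryGroup e V.2⟩
  | @Step.queryState _ _ _ _ _ _ inv R _ _ f => .queryState inv (R × S) (subRegister e f)
  | @Step.querySelect _ _ _ _ _ _ j inv R _ _ f => .querySelect j inv (R × S) (subRegister e f)
  | @Step.queryPrepare _ _ _ _ _ _ j inv R _ _ f => .queryPrepare j inv (R × S) (subRegister e f)

variable {Ω' S : Type} [Fintype Ω'] [DecidableEq Ω'] [Fintype S] [DecidableEq S]

theorem Step.lift_matrix (O : Oracles d n) (e : Ω' ≃ Ω × S) (s : Step d n Ω) :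
    (s.lift e).matrix O = onRegister e (s.matrix O) := by
  cases s with
  | gate V => rfl
  | queryState inv R f => exact onRegister_subRegister e f _
  | querySelect j inv R f => exact onRegister_subRegister e f _
  | queryPrepare j inv R f => exact onRegister_subRegister e f _

@[simp] theorem Step.lift_cost (e : Ω' ≃ Ω × S) (s : Step d n Ω) : (s.lift e).cost = s.cost := by
  cases s <;> rfl

theorem Step.lift_cost_sum (e : Ω' ≃ Ω × S) (l : List (Step d n Ω)) :
    ((l.map (Step.lift e)).map Step.cost).sum = (l.map Step.cost).sum := by
  simp [List.map_map, Function.comp_def]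

theorem run_lift (O : Oracles d n) (e : Ω' ≃ Ω × S) (l : List (Step d n Ω)) (v : Ω' → ℂ)
    (x : Ω') : run O (l.map (Step.lift e)) v x =
      run O l (fun i => v (e.symm (i, (e x).2))) (e x).1 := by
  induction l generalizing v with
  | nil => simp
  | cons s l ih =>
    rw [List.map_cons, run_cons, run_cons, ih]
    congr 1
    ext i
    rw [Step.lift_matrix, onRegister_mulVec]
    simp

end Run

/-! ### Algorithms in parallel -/

section Parallel

variable {d J : ℕ} {n : Fin J → ℕ} {I : Type} [Fintype I] [DecidableEq I]

/-- The algorithm that performs the algorithms of a finite family one after the other, each on a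
workspace of its own, and computes its output from all the outcomes. -/
def parallel (alg : I → QueryAlgorithm d n) (out : (∀ i, (alg i).Ω) → ℝ) :
    QueryAlgorithm d n where
  Ω := ∀ i, (alg i).Ω
  start := fun i => (alg i).start
  steps := (Finset.univ : Finset I).toList.flatMap fun i =>
    (alg i).steps.map (Step.lift (Equiv.piSplitAt i fun i => (alg i).Ω))
  output := out

theorem parallel_queries (alg : I → QueryAlgorithm d n) (out : (∀ i, (alg i).Ω) → ℝ) :
    (parallel alg out).queries = ∑ i, (alg i).queries := by
  have h : ∀ l : List I, ((l.flatMap fun i =>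
      (alg i).steps.map (Step.lift (Equiv.piSplitAt i fun i => (alg i).Ω))).map Step.cost).sum =
        (l.map fun i => (alg i).queries).sum := by
    intro l
    induction l with
    | nil => rfl
    | cons i l ih =>
      rw [List.flatMap_cons, List.map_append, List.sum_append, ih, Step.lift_cost_sum]
      rfl
  exact (h _).trans (Finset.sum_map_toList _ _)

/-- The final state of a parallel algorithm is a product vector. -/
theorem parallel_finalState (alg : I → QueryAlgorithm d n) (out : (∀ i, (alg i).Ω) → ℝ)
    (O : Oracles d n) (x : ∀ i, (alg i).Ω) :
    (parallel alg out).finalState O x = ∏ i, (alg i).finalState O (x i) := by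
  have h : ∀ l : List I, l.Nodup → ∀ v : ∀ i, (alg i).Ω → ℂ,
      run O (l.flatMap fun i =>
        (alg i).steps.map (Step.lift (Equiv.piSplitAt i fun i => (alg i).Ω)))
        (fun x => ∏ i, v i (x i)) =
      fun x => ∏ i, (if i ∈ l then run O (alg i).steps (v i) else v i) (x i) := by
    intro l
    induction l with
    | nil => intro _ v; simp
    | cons i l ih =>
      intro hl v
      rw [List.flatMap_cons, run_append]
      have h1 : run O ((alg i).steps.map (Step.lift (Equiv.piSplitAt i fun i => (alg i).Ω)))
          (fun x => ∏ i, v i (x i)) =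
          fun x => ∏ i', Function.update v i (run O (alg i).steps (v i)) i' (x i') := by
        ext x
        rw [run_lift]
        have h2 : (fun a => ∏ i', v i' ((Equiv.piSplitAt i fun i => (alg i).Ω).symm
            (a, ((Equiv.piSplitAt i fun i => (alg i).Ω) x).2) i')) =
            (∏ i' ∈ Finset.univ.erase i, v i' (x i')) • v i := by
          ext a
          rw [← Finset.mul_prod_erase _ _ (Finset.mem_univ i), mul_comm]
          simp only [Pi.smul_apply, smul_eq_mul, Equiv.piSplitAt]
          congr 1
          · refine Finset.prod_congr rfl fun i' hi' => ?_
            simp [(Finset.mem_erase.1 hi').1]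
          · simp
        have h3 : ∀ (m : List (Step d n (alg i).Ω)) (a : ℂ) (w : (alg i).Ω → ℂ),
            run O m (a • w) = a • run O m w := by
          intro m a
          induction m with
          | nil => intro w; rfl
          | cons s m ih => intro w; rw [run_cons, run_cons, Matrix.mulVec_smul, ih]
        rw [h2, h3, ← Finset.mul_prod_erase _ _ (Finset.mem_univ i), mul_comm]
        simp only [Pi.smul_apply, smul_eq_mul, Function.update_self, Equiv.piSplitAt]
        congr 1
        refine Finset.prod_congr rfl fun i' hi' => ?_
        simp [(Finset.mem_erase.1 hi').1]
      rw [h1, ih (List.nodup_cons.1 hl).2]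
      ext x
      refine Finset.prod_congr rfl fun i' _ => ?_
      by_cases hi : i' = i
      · subst hi
        simp [(List.nodup_cons.1 hl).1]
      · simp [hi]
  have h0 : ket (parallel alg out).start = fun x => ∏ i, ket (alg i).start (x i) := by
    ext x
    by_cases hx : x = (parallel alg out).start
    · subst hx
      exact (Pi.single_eq_same _ _).trans (by simp [ket, parallel])
    · obtain ⟨i, hi⟩ := Function.ne_iff.1 hx
      rw [Finset.prod_eq_zero (Finset.mem_univ i) (Pi.single_eq_of_ne hi _)]
      exact Pi.single_eq_of_ne hx _
  have h4 := h _ (Finset.nodup_toList Finset.univ) fun i => ket (alg i).start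
  simp only [Finset.mem_toList, Finset.mem_univ, if_true] at h4
  exact (congrArg (fun w => run O (parallel alg out).steps w x) h0).trans (congrFun h4 x)

theorem QueryAlgorithm.sum_norm_sq_finalState (alg : QueryAlgorithm d n) (O : Oracles d n) :
    ∑ x, ‖alg.finalState O x‖ ^ 2 = 1 := by
  refine (sum_norm_sq_run O alg.steps (ket alg.start)).trans ?_
  rw [Finset.sum_eq_single alg.start] <;> simp +contextual [ket]

end Parallel

/-! ### The path matrix and its sine window -/

section Path

/-- Measuring the state `v` in an eigenbasis of the Hermitian matrix `X` yields an eigenvalue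
whose mean square deviation from `m` is `‖(X - m) v‖²`. -/
theorem sum_eigenvalue_deviation {ι : Type} [Fintype ι] [DecidableEq ι] {X : Matrix ι ι ℂ}
    (hX : X.IsHermitian) (v : ι → ℂ) (m : ℝ) :
    ∑ y, (hX.eigenvalues y - m) ^ 2 * ‖((star hX.eigenvectorUnitary.1) *ᵥ v) y‖ ^ 2 =
      ∑ t, ‖(X *ᵥ v) t - m * v t‖ ^ 2 := by
  have hU := hX.eigenvectorUnitary.2
  have h1 : star hX.eigenvectorUnitary.1 * X =
      Matrix.diagonal (RCLike.ofReal ∘ hX.eigenvalues) * star hX.eigenvectorUnitary.1 := by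
    have h := hX.conjStarAlgAut_star_eigenvectorUnitary
    rw [Unitary.conjStarAlgAut_star_apply] at h
    rw [← h, mul_assoc _ _ (star _), Matrix.mem_unitaryGroup_iff.1 hU, mul_one]
  have h2 := sum_norm_sq_mulVec (Unitary.star_mem hU) (X *ᵥ v - (m : ℂ) • v)
  simp only [Pi.sub_apply, Pi.smul_apply, smul_eq_mul] at h2
  rw [← h2]
  refine Finset.sum_congr rfl fun y _ => ?_
  rw [Matrix.mulVec_sub, Matrix.mulVec_mulVec, h1, ← Matrix.mulVec_mulVec, Matrix.mulVec_smul,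
    Pi.sub_apply, Matrix.mulVec_diagonal, Pi.smul_apply, smul_eq_mul, ← sub_mul, norm_mul, mul_pow]
  congr 1
  rw [← sq_abs, ← Real.norm_eq_abs, ← Complex.norm_real, Complex.ofReal_sub]
  rfl

/-- Every unit vector is the image of a given basis vector under some unitary. -/
theorem exists_unitary_mulVec_ket {ι : Type} [Fintype ι] [DecidableEq ι] (i : ι) (c : ι → ℂ)
    (hc : ∑ x, ‖c x‖ ^ 2 = 1) : ∃ A : Matrix.unitaryGroup ι ℂ, A.1 *ᵥ ket i = c := by
  have hn : ‖WithLp.toLp 2 c‖ = 1 := by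
    rw [EuclideanSpace.norm_eq, ← Real.sqrt_one]
    exact congrArg _ hc
  have ho : Orthonormal ℂ (({i} : Set ι).domRestrict fun _ => WithLp.toLp 2 c) := by
    rw [orthonormal_iff_ite]
    rintro ⟨a, rfl⟩ ⟨b, rfl⟩
    simp [Set.domRestrict, hn, inner_self_eq_norm_sq_to_K]
  obtain ⟨b, hb⟩ := ho.exists_orthonormalBasis_extension_of_card_eq (by simp)
  refine ⟨⟨_, (EuclideanSpace.basisFun ι ℂ).toMatrix_orthonormalBasis_mem_unitary b⟩, ?_⟩
  ext x
  simp [ket, hb i rfl, Module.Basis.toMatrix_apply]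

/-- Half the adjacency matrix of the path with vertices `0, …, K`. -/
def pathMatrix (K : ℕ) : Matrix (Fin (K + 1)) (Fin (K + 1)) ℂ :=
  Matrix.of fun s t => if (t : ℕ) = s + 1 then 1 / 2 else if (s : ℕ) = t + 1 then 1 / 2 else 0

theorem pathMatrix_isHermitian (K : ℕ) : (pathMatrix K).IsHermitian := by
  ext s t
  simp only [pathMatrix, Matrix.conjTranspose_apply, Matrix.of_apply]
  split_ifs <;> first | omega | simp

theorem pathMatrix_mulVec {K : ℕ} (g : ℕ → ℂ) (h0 : g 0 = 0) (hK : g (K + 2) = 0)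
    (s : Fin (K + 1)) :
    (pathMatrix K *ᵥ fun t => g (t + 1)) s = (g (s + 2) + g s) / 2 := by
  have h : ∀ t : Fin (K + 1), pathMatrix K s t * g (t + 1) =
      (fun t : ℕ => (if t = s + 1 then g (s + 2) / 2 else 0) +
        (if t + 1 = s then g s / 2 else 0)) t := by
    intro t
    simp only [pathMatrix, Matrix.of_apply]
    split_ifs with h1 h2 h3 h4 h5
    · omega
    · rw [h1]; ring
    · rw [h3]; ring
    · omega
    · omega
    · ring
  simp only [Matrix.mulVec, dotProduct, h]
  rw [Fin.sum_univ_eq_sum_range (fun t : ℕ => (if t = s + 1 then g (s + 2) / 2 else 0) +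
    (if t + 1 = s then g s / 2 else 0)), Finset.sum_add_distrib, add_div, Finset.sum_ite_eq']
  congr 1
  · split_ifs with h1
    · rfl
    · have : (s : ℕ) = K := by have := s.2; simp at h1; omega
      rw [this, hK, zero_div]
  · rcases hs : (s : ℕ) with _ | r
    · simp [h0]
    · simp only [add_left_inj]
      rw [Finset.sum_ite_eq', if_pos (Finset.mem_range.2 (by omega))]

/-- The normalized sine window, a unit eigenvector of the path matrix. -/
theorem exists_window (K : ℕ) : ∃ f : ℕ → ℝ, f 0 = 0 ∧ f (K + 2) = 0 ∧
    (∀ k, f (k + 2) + f k = 2 * Real.cos (Real.pi / (K + 2)) * f (k + 1)) ∧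
    ∑ t : Fin (K + 1), f (t + 1) ^ 2 = 1 := by
  set α := Real.pi / (K + 2) with hα
  have hpos : 0 < ∑ t : Fin (K + 1), Real.sin ((t + 1 : ℕ) * α) ^ 2 := by
    refine Finset.sum_pos' (fun _ _ => sq_nonneg _) ⟨0, Finset.mem_univ _, ?_⟩
    have : 0 < Real.sin α := Real.sin_pos_of_pos_of_lt_pi (by positivity)
      (div_lt_self Real.pi_pos (by linarith [(Nat.cast_nonneg K : (0:ℝ) ≤ K)]))
    simpa using pow_pos this 2
  set r := √(∑ t : Fin (K + 1), Real.sin ((t + 1 : ℕ) * α) ^ 2)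
  refine ⟨fun k => Real.sin (k * α) / r, by simp, ?_, fun k => ?_, ?_⟩
  · have : ((K + 2 : ℕ) : ℝ) * α = Real.pi := by
      rw [hα]; push_cast; field_simp
    simp only [this, Real.sin_pi, zero_div]
  · have h1 : ((k + 2 : ℕ) : ℝ) * α = (k + 1 : ℕ) * α + α := by push_cast; ring
    have h2 : (k : ℝ) * α = (k + 1 : ℕ) * α - α := by push_cast; ring
    simp only [h1, h2, Real.sin_add, Real.sin_sub]
    ring
  · simp only [div_pow, ← Finset.sum_div]
    rw [Real.sq_sqrt hpos.le, div_self hpos.ne']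

/-- The product of two solutions of three term recurrences with parameters `l` and `m`, averaged
over its two neighbours, is `l * m` times itself up to a product of differences. -/
theorem norm_sq_window_deviation {a b c l m : ℝ} {A B C : ℂ} (h : a + b = 2 * l * c)
    (H : A + B = 2 * m * C) :
    ‖(a * A + b * B) / 2 - m * (c * C)‖ ^ 2 ≤ 2 * (1 - l) ^ 2 * m ^ 2 * c ^ 2 * ‖C‖ ^ 2 +
      (a - b) ^ 2 / 8 * (2 * ‖A‖ ^ 2 + 2 * ‖B‖ ^ 2 - 4 * m ^ 2 * ‖C‖ ^ 2) := by
  have hB : B = 2 * m * C - A := by rw [← H]; ring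
  have hb : b = 2 * l * c - a := by rw [← h]; ring
  have h1 : (a * A + b * B) / 2 - m * (c * C) =
      ((l - 1) * m * c : ℝ) * C + ((a - b) / 4 : ℝ) * (A - B) := by
    rw [hB, hb]; push_cast; ring
  have h2 := parallelogram_law_with_norm ℝ A B
  have h3 : ‖A + B‖ ^ 2 = 4 * m ^ 2 * ‖C‖ ^ 2 := by
    rw [H, norm_mul, norm_mul, mul_pow, mul_pow, Complex.norm_real, Real.norm_eq_abs, sq_abs]
    norm_num
  rw [h1]
  set u := (((l - 1) * m * c : ℝ) : ℂ) * C
  set v := (((a - b) / 4 : ℝ) : ℂ) * (A - B)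
  have hu : ‖u‖ ^ 2 = ((l - 1) * m * c) ^ 2 * ‖C‖ ^ 2 := by
    simp only [u, norm_mul, mul_pow, Complex.norm_real, Real.norm_eq_abs, sq_abs]
  have hv : ‖v‖ ^ 2 = ((a - b) / 4) ^ 2 * ‖A - B‖ ^ 2 := by
    simp only [v, norm_mul, mul_pow, Complex.norm_real, Real.norm_eq_abs, sq_abs]
  have h4 : ‖u + v‖ ^ 2 ≤ 2 * ‖u‖ ^ 2 + 2 * ‖v‖ ^ 2 := by
    nlinarith [norm_add_le u v, norm_nonneg (u + v), sq_nonneg (‖u‖ - ‖v‖)]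
  -- Parallelogram identity.
  have h5 : ‖A - B‖ ^ 2 = 2 * ‖A‖ ^ 2 + 2 * ‖B‖ ^ 2 - 4 * m ^ 2 * ‖C‖ ^ 2 := by
    rw [← h3]; linarith
  rw [hu, hv, h5] at h4
  linarith

/-- If both the window `f` and the vectors `W k` satisfy a three term recurrence, with parameters
`l` and `m`, then the vector with components `f (t + 1) • W (t + 1)` is an approximate eigenvector
of the path matrix for the eigenvalue `m`. -/
theorem sum_window_deviation_le {K : ℕ} {S : Type} [Fintype S] {f : ℕ → ℝ} {l m : ℝ}
    {W : ℕ → S → ℂ} (h0 : f 0 = 0) (hK : f (K + 2) = 0)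
    (hf : ∀ k, f (k + 2) + f k = 2 * l * f (k + 1))
    (hf1 : ∑ t : Fin (K + 1), f (t + 1) ^ 2 = 1) (hW1 : ∀ k, ∑ x, ‖W k x‖ ^ 2 = 1)
    (hW : ∀ k x, W (k + 2) x + W k x = 2 * m * W (k + 1) x) (hm : m ^ 2 ≤ 1) :
    ∑ x, ∑ t : Fin (K + 1),
      ‖(f (t + 2) * W (t + 2) x + f t * W t x) / 2 - m * (f (t + 1) * W (t + 1) x)‖ ^ 2 ≤
      2 * (1 - l) ^ 2 + 2 * (1 - l ^ 2) * (1 - m ^ 2) := by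
  have h1 : ∀ t : Fin (K + 1), ∑ x,
      ‖(f (t + 2) * W (t + 2) x + f t * W t x) / 2 - m * (f (t + 1) * W (t + 1) x)‖ ^ 2 ≤
      2 * (1 - l) ^ 2 * f (t + 1) ^ 2 + (f (t + 2) - f t) ^ 2 / 2 * (1 - m ^ 2) := by
    intro t
    refine (Finset.sum_le_sum fun x _ => norm_sq_window_deviation (hf t) (hW t x)).trans ?_
    have h2 : (∑ x, (2 * (1 - l) ^ 2 * m ^ 2 * f (t + 1) ^ 2 * ‖W (t + 1) x‖ ^ 2 +
        (f (t + 2) - f t) ^ 2 / 8 * (2 * ‖W (t + 2) x‖ ^ 2 + 2 * ‖W t x‖ ^ 2 -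
          4 * m ^ 2 * ‖W (t + 1) x‖ ^ 2))) =
        2 * (1 - l) ^ 2 * f (t + 1) ^ 2 * m ^ 2 + (f (t + 2) - f t) ^ 2 / 2 * (1 - m ^ 2) := by
      rw [Finset.sum_add_distrib, ← Finset.mul_sum, ← Finset.mul_sum, Finset.sum_sub_distrib,
        Finset.sum_add_distrib, ← Finset.mul_sum, ← Finset.mul_sum, ← Finset.mul_sum, hW1, hW1, hW1]
      ring
    rw [h2]
    exact add_le_add_left (mul_le_of_le_one_right (by positivity) hm) _
  rw [Finset.sum_comm]
  refine (Finset.sum_le_sum fun t _ => h1 t).trans ?_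
  rw [Finset.sum_add_distrib, ← Finset.mul_sum, hf1, ← Finset.sum_mul, ← Finset.sum_div, mul_one]
  have h3 : ∑ t : Fin (K + 1), (f (t + 2) - f t) ^ 2 ≤ 4 * (1 - l ^ 2) := by
    have h4 : ∀ t : Fin (K + 1), (f (t + 2) - f t) ^ 2 =
        2 * f (t + 2) ^ 2 + 2 * f t ^ 2 - 4 * l ^ 2 * f (t + 1) ^ 2 := by
      intro t
      have := hf t
      linear_combination (-(f (t + 2) + f t + 2 * l * f (t + 1))) * this
    -- The boundary values vanish, so that a shift of the window does not increase its norm.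
    have h5 : ∑ t : Fin (K + 1), f (t + 2) ^ 2 ≤ 1 := by
      rw [← hf1, Fin.sum_univ_eq_sum_range (fun t => f (t + 2) ^ 2),
        Fin.sum_univ_eq_sum_range (fun t => f (t + 1) ^ 2), Finset.sum_range_succ, hK,
        Finset.sum_range_succ']
      simp only [ne_eq, OfNat.ofNat_ne_zero, not_false_eq_true, zero_pow, add_zero]
      exact le_add_of_nonneg_right (sq_nonneg _)
    have h6 : ∑ t : Fin (K + 1), f t ^ 2 ≤ 1 := by
      rw [← hf1, Fin.sum_univ_eq_sum_range (fun t => f t ^ 2),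
        Fin.sum_univ_eq_sum_range (fun t => f (t + 1) ^ 2), Finset.sum_range_succ', h0,
        Finset.sum_range_succ]
      simp only [ne_eq, OfNat.ofNat_ne_zero, not_false_eq_true, zero_pow, add_zero]
      exact le_add_of_nonneg_right (sq_nonneg _)
    simp only [h4, Finset.sum_sub_distrib, Finset.sum_add_distrib, ← Finset.mul_sum, hf1]
    linarith
  have h7 : (∑ t : Fin (K + 1), (f (t + 2) - f t) ^ 2) / 2 ≤ 2 * (1 - l ^ 2) := by linarith
  have h8 := mul_le_mul_of_nonneg_right h7 (sub_nonneg.2 hm)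
  linarith

end Path

/-! ### Amplitude estimation -/

section Amplitude

variable {Ω : Type} [Fintype Ω] [DecidableEq Ω]

/-- The diagonal matrix with entries `-1` on the set `s` and `1` elsewhere. -/
def signMatrix (s : Ω → Prop) [DecidablePred s] : Matrix Ω Ω ℂ :=
  Matrix.diagonal fun x => if s x then -1 else 1

omit [Fintype Ω] in
theorem signMatrix_conjTranspose (s : Ω → Prop) [DecidablePred s] :
    (signMatrix s)ᴴ = signMatrix s := by
  rw [signMatrix, Matrix.diagonal_conjTranspose]
  congr 1
  ext x
  by_cases h : s x <;> simp [h]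

theorem signMatrix_mul_self (s : Ω → Prop) [DecidablePred s] :
    signMatrix s * signMatrix s = 1 := by
  rw [signMatrix, Matrix.diagonal_mul_diagonal, ← Matrix.diagonal_one]
  congr 1
  ext x
  split_ifs <;> simp

theorem signMatrix_mulVec (s : Ω → Prop) [DecidablePred s] (v : Ω → ℂ) (x : Ω) :
    (signMatrix s *ᵥ v) x = if s x then -v x else v x := by
  rw [signMatrix, Matrix.mulVec_diagonal]
  split_ifs <;> simp

theorem signMatrix_mem_unitaryGroup (s : Ω → Prop) [DecidablePred s] :
    signMatrix s ∈ Matrix.unitaryGroup Ω ℂ := by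
  rw [Matrix.mem_unitaryGroup_iff, Matrix.star_eq_conjTranspose, signMatrix_conjTranspose,
    signMatrix_mul_self]

/-- The Grover iterate of the unitary `V` for the initial basis state `a` and the good basis
states `g`: the reflection through the state `V |a⟩` after the sign flip of the good states. -/
def grover (V : Matrix Ω Ω ℂ) (a : Ω) (g : Ω → Prop) [DecidablePred g] : Matrix Ω Ω ℂ :=
  V * signMatrix (· ≠ a) * Vᴴ * signMatrix g

/-- The probability that the measurement of `V |a⟩` yields a good basis state. -/
def goodProb (V : Matrix Ω Ω ℂ) (a : Ω) (g : Ω → Prop) [DecidablePred g] : ℝ :=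
  ∑ x, if g x then ‖(V *ᵥ ket a) x‖ ^ 2 else 0

theorem sum_norm_sq_mulVec_ket {V : Matrix Ω Ω ℂ} (hV : V ∈ Matrix.unitaryGroup Ω ℂ) (a : Ω) :
    ∑ x, ‖(V *ᵥ ket a) x‖ ^ 2 = 1 := by
  rw [sum_norm_sq_mulVec hV, Finset.sum_eq_single a] <;> simp +contextual [ket]

theorem goodProb_nonneg (V : Matrix Ω Ω ℂ) (a : Ω) (g : Ω → Prop) [DecidablePred g] :
    0 ≤ goodProb V a g :=
  Finset.sum_nonneg fun x _ => by split_ifs <;> positivity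

theorem goodProb_le_one {V : Matrix Ω Ω ℂ} (hV : V ∈ Matrix.unitaryGroup Ω ℂ) (a : Ω)
    (g : Ω → Prop) [DecidablePred g] : goodProb V a g ≤ 1 := by
  rw [← sum_norm_sq_mulVec_ket hV a]
  exact Finset.sum_le_sum fun x _ => by split_ifs <;> simp

/-- The vectors `Q ^ (k - 1) V |a⟩` of the Grover iteration `Q`. The index is shifted so that the
sequence starts with `Q⁻¹ V |a⟩`, which is `V |a⟩` with the sign of its good part flipped. -/
def groverVec (V : Matrix Ω Ω ℂ) (a : Ω) (g : Ω → Prop) [DecidablePred g] (k : ℕ) : Ω → ℂ :=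
  (grover V a g ^ k) *ᵥ (signMatrix g *ᵥ (V *ᵥ ket a))

theorem grover_mem_unitaryGroup {V : Matrix Ω Ω ℂ} (hV : V ∈ Matrix.unitaryGroup Ω ℂ) (a : Ω)
    (g : Ω → Prop) [DecidablePred g] : grover V a g ∈ Matrix.unitaryGroup Ω ℂ :=
  mul_mem (mul_mem (mul_mem hV (signMatrix_mem_unitaryGroup _)) (Unitary.star_mem hV))
    (signMatrix_mem_unitaryGroup _)

theorem sum_norm_sq_groverVec {V : Matrix Ω Ω ℂ} (hV : V ∈ Matrix.unitaryGroup Ω ℂ) (a : Ω)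
    (g : Ω → Prop) [DecidablePred g] (k : ℕ) : ∑ x, ‖groverVec V a g k x‖ ^ 2 = 1 := by
  rw [groverVec, sum_norm_sq_mulVec (pow_mem (grover_mem_unitaryGroup hV a g) k),
    sum_norm_sq_mulVec (signMatrix_mem_unitaryGroup g), sum_norm_sq_mulVec_ket hV]

theorem groverVec_succ (V : Matrix Ω Ω ℂ) (a : Ω) (g : Ω → Prop) [DecidablePred g] (k : ℕ) :
    groverVec V a g (k + 1) = grover V a g *ᵥ groverVec V a g k := by
  rw [groverVec, pow_succ', ← Matrix.mulVec_mulVec]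
  rfl

theorem conjTranspose_mulVec_mulVec {V : Matrix Ω Ω ℂ} (hV : V ∈ Matrix.unitaryGroup Ω ℂ)
    (v : Ω → ℂ) : Vᴴ *ᵥ (V *ᵥ v) = v := by
  rw [Matrix.mulVec_mulVec, ← Matrix.star_eq_conjTranspose, Matrix.mem_unitaryGroup_iff'.1 hV,
    Matrix.one_mulVec]

theorem mulVec_conjTranspose_mulVec {V : Matrix Ω Ω ℂ} (hV : V ∈ Matrix.unitaryGroup Ω ℂ)
    (v : Ω → ℂ) : V *ᵥ (Vᴴ *ᵥ v) = v := by
  rw [Matrix.mulVec_mulVec, ← Matrix.star_eq_conjTranspose, Matrix.mem_unitaryGroup_iff.1 hV,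
    Matrix.one_mulVec]

theorem groverVec_one {V : Matrix Ω Ω ℂ} (hV : V ∈ Matrix.unitaryGroup Ω ℂ) (a : Ω)
    (g : Ω → Prop) [DecidablePred g] : groverVec V a g 1 = V *ᵥ ket a := by
  have h : signMatrix (· ≠ a) *ᵥ ket a = ket a := by
    ext x
    rw [signMatrix_mulVec]
    by_cases hx : x = a <;> simp [hx, ket]
  simp only [groverVec, pow_one, grover, ← Matrix.mulVec_mulVec]
  rw [Matrix.mulVec_mulVec _ (signMatrix g), signMatrix_mul_self, Matrix.one_mulVec,
    conjTranspose_mulVec_mulVec hV, h]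

/-- The overlap of `V |a⟩` with its image under the sign flip of the good states. -/
theorem star_dotProduct_signMatrix_mulVec {V : Matrix Ω Ω ℂ} (hV : V ∈ Matrix.unitaryGroup Ω ℂ)
    (a : Ω) (g : Ω → Prop) [DecidablePred g] :
    star (V *ᵥ ket a) ⬝ᵥ (signMatrix g *ᵥ (V *ᵥ ket a)) = ((1 - 2 * goodProb V a g : ℝ) : ℂ) := by
  rw [← sum_norm_sq_mulVec_ket hV a, goodProb, Finset.mul_sum, ← Finset.sum_sub_distrib,
    Complex.ofReal_sum]
  refine Finset.sum_congr rfl fun x _ => ?_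
  have h : (starRingEnd ℂ) ((V *ᵥ ket a) x) * (V *ᵥ ket a) x = ((‖(V *ᵥ ket a) x‖ : ℝ) : ℂ) ^ 2 :=
    RCLike.conj_mul _
  rw [signMatrix_mulVec]
  simp only [Pi.star_apply, RCLike.star_def]
  split_ifs
  · rw [mul_neg, h]; push_cast; ring
  · rw [h]; push_cast; ring

/-- The three term recurrence of the Grover iteration. It is that of the Chebyshev polynomials,
since the iteration rotates a plane by an angle with cosine `1 - 2 p`. -/
theorem groverVec_recurrence {V : Matrix Ω Ω ℂ} (hV : V ∈ Matrix.unitaryGroup Ω ℂ) (a : Ω)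
    (g : Ω → Prop) [DecidablePred g] (k : ℕ) (x : Ω) :
    groverVec V a g (k + 2) x + groverVec V a g k x =
      2 * ((1 - 2 * goodProb V a g : ℝ) : ℂ) * groverVec V a g (k + 1) x := by
  have h0 : groverVec V a g 2 + groverVec V a g 0 =
      (2 * ((1 - 2 * goodProb V a g : ℝ) : ℂ)) • groverVec V a g 1 := by
    -- The sign flip of all states but `a` is the reflection `2 |a⟩⟨a| - 1`.
    have hz : ∀ w : Ω → ℂ, signMatrix (· ≠ a) *ᵥ w = (2 * w a) • ket a - w := by
      intro w
      ext x
      rw [signMatrix_mulVec]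
      by_cases hx : x = a
      · subst hx; simp [ket]; ring
      · simp [ket, hx]
    have ha : (Vᴴ *ᵥ (signMatrix g *ᵥ (V *ᵥ ket a))) a = ((1 - 2 * goodProb V a g : ℝ) : ℂ) := by
      rw [← star_dotProduct_signMatrix_mulVec hV]
      simp [Matrix.mulVec, dotProduct, ket, Matrix.conjTranspose_apply]
    rw [groverVec_succ, groverVec_one hV]
    simp only [grover, ← Matrix.mulVec_mulVec]
    rw [hz, ha, Matrix.mulVec_sub, Matrix.mulVec_smul,
      mulVec_conjTranspose_mulVec hV]
    simp [groverVec]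
  have h : groverVec V a g (k + 2) + groverVec V a g k =
      (2 * ((1 - 2 * goodProb V a g : ℝ) : ℂ)) • groverVec V a g (k + 1) := by
    have h1 : ∀ i, groverVec V a g (k + i) = (grover V a g ^ k) *ᵥ groverVec V a g i := by
      intro i
      rw [groverVec, pow_add, ← Matrix.mulVec_mulVec]
      rfl
    rw [h1, h1 1, ← Matrix.mulVec_smul, ← h0, Matrix.mulVec_add, ← h1 0, add_zero]
  exact congrFun h x

end Amplitude

section Circuit

variable {d J : ℕ} {n : Fin J → ℕ} {Ω : Type} [Fintype Ω] [DecidableEq Ω]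

/-- The steps that apply the Grover iterate if the time register exceeds `r`. The steps `l` and
`l'` perform a unitary `V` and its inverse. Only the reflections are controlled: without them `V`
and its inverse cancel. -/
def groverSteps (K : ℕ) (l l' : List (Step d n Ω)) (a : Ω) (g : Ω → Prop) [DecidablePred g]
    (r : ℕ) : List (Step d n (Ω × Fin (K + 1))) :=
  .gate ⟨_, signMatrix_mem_unitaryGroup fun x : Ω × Fin (K + 1) => r < (x.2 : ℕ) ∧ g x.1⟩ ::
    (l'.map (Step.lift (Equiv.refl _)) ++
      .gate ⟨_, signMatrix_mem_unitaryGroup fun x : Ω × Fin (K + 1) => r < (x.2 : ℕ) ∧ x.1 ≠ a⟩ ::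
        l.map (Step.lift (Equiv.refl _)))

theorem signMatrix_controlled_mulVec (K r : ℕ) (s : Ω → Prop) [DecidablePred s]
    (v : Ω × Fin (K + 1) → ℂ) (x : Ω) (t : Fin (K + 1)) :
    (signMatrix (fun x : Ω × Fin (K + 1) => r < (x.2 : ℕ) ∧ s x.1) *ᵥ v) (x, t) =
      if r < t then (signMatrix s *ᵥ fun y => v (y, t)) x else v (x, t) := by
  rw [signMatrix_mulVec, signMatrix_mulVec]
  by_cases h : r < (t : ℕ) <;> simp [h]

theorem run_groverSteps (K : ℕ) {l l' : List (Step d n Ω)} (a : Ω) (g : Ω → Prop)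
    [DecidablePred g] (O : Oracles d n) {V : Matrix Ω Ω ℂ} (hV : V ∈ Matrix.unitaryGroup Ω ℂ)
    (hl : ∀ v, run O l v = V *ᵥ v) (hl' : ∀ v, run O l' v = Vᴴ *ᵥ v) (r : ℕ)
    (v : Ω × Fin (K + 1) → ℂ) (x : Ω) (t : Fin (K + 1)) :
    run O (groverSteps K l l' a g r) v (x, t) =
      if r < t then (grover V a g *ᵥ fun y => v (y, t)) x else v (x, t) := by
  have ha := signMatrix_controlled_mulVec K r (· ≠ a)
  have hg := signMatrix_controlled_mulVec K r g
  simp only [groverSteps, run_cons, run_append, run_lift, hl, Step.matrix, Equiv.refl_apply,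
    Equiv.refl_symm, ha]
  split_ifs with h
  · simp only [hl', hg, h, if_true, grover, ← Matrix.mulVec_mulVec]
  · simp only [hl', hg, h, if_false]
    rw [mulVec_conjTranspose_mulVec hV]

/-- The steps of amplitude estimation with time register `{0, …, K}`: prepare the superposition
`∑ₜ cₜ |t⟩ Qᵗ V |a⟩`, where `c` is the first column of the unitary `A`, and
turn the time register by the unitary `B`. -/
def estimationSteps (K : ℕ) (A B : Matrix.unitaryGroup (Fin (K + 1)) ℂ)
    (l l' : List (Step d n Ω)) (a : Ω) (g : Ω → Prop) [DecidablePred g] :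
    List (Step d n (Ω × Fin (K + 1))) :=
  .gate ⟨_, onRegister_mem_unitaryGroup (Equiv.prodComm Ω (Fin (K + 1))) A.2⟩ ::
    (l.map (Step.lift (Equiv.refl _)) ++ ((List.range K).flatMap (groverSteps K l l' a g) ++
      [.gate ⟨_, onRegister_mem_unitaryGroup (Equiv.prodComm Ω (Fin (K + 1))) B.2⟩]))

/-- The time register `t` undergoes `min K t` Grover iterations, that is `t`, between the two
unitaries on it. -/
theorem run_estimationSteps (K : ℕ) (A B : Matrix.unitaryGroup (Fin (K + 1)) ℂ)
    {l l' : List (Step d n Ω)} (a : Ω) (g : Ω → Prop)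
    [DecidablePred g] (O : Oracles d n) {V : Matrix Ω Ω ℂ} (hV : V ∈ Matrix.unitaryGroup Ω ℂ)
    (hl : ∀ v, run O l v = V *ᵥ v) (hl' : ∀ v, run O l' v = Vᴴ *ᵥ v)
    (x : Ω) (y : Fin (K + 1)) :
    run O (estimationSteps K A B l l' a g) (ket (a, 0)) (x, y) =
      (B.1 *ᵥ fun t => (A.1 *ᵥ ket 0) t * groverVec V a g (t + 1) x) y := by
  have h1 : ∀ R ≤ K, ∀ x t, run O ((List.range R).flatMap (groverSteps K l l' a g))
      (fun x => (A.1 *ᵥ ket 0) x.2 * groverVec V a g 1 x.1) (x, t) =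
      (A.1 *ᵥ ket 0) t * groverVec V a g (min R t + 1) x := by
    intro R hR
    induction R with
    | zero => intro x t; simp
    | succ R ih =>
      intro x t
      rw [List.range_succ, List.flatMap_append, run_append, List.flatMap_singleton,
        run_groverSteps K a g O hV hl hl', ih (by omega)]
      simp only [ih (Nat.le_of_succ_le hR)]
      split_ifs with h
      · have h2 : (fun y => (A.1 *ᵥ ket 0) t * groverVec V a g (min R t + 1) y) =
            (A.1 *ᵥ ket 0) t • groverVec V a g (min R t + 1) := rfl
        rw [h2, Matrix.mulVec_smul, ← groverVec_succ, Pi.smul_apply, smul_eq_mul,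
          min_eq_left h.le, min_eq_left (Nat.succ_le_of_lt h)]
      · rw [min_eq_right (not_lt.1 h), min_eq_right ((not_lt.1 h).trans (Nat.le_succ R))]
  have h3 : run O (l.map (Step.lift (Equiv.refl _)))
      (onRegister (Equiv.prodComm Ω (Fin (K + 1))) A.1 *ᵥ ket (a, 0)) =
      fun x => (A.1 *ᵥ ket 0) x.2 * groverVec V a g 1 x.1 := by
    ext ⟨x, t⟩
    rw [run_lift, hl, groverVec_one hV]
    have h4 : (fun i => (onRegister (Equiv.prodComm Ω (Fin (K + 1))) A.1 *ᵥ ket (a, 0))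
        ((Equiv.refl (Ω × Fin (K + 1))).symm (i, ((Equiv.refl _) (x, t)).2))) =
        (A.1 *ᵥ ket 0) t • ket a := by
      ext i
      rw [onRegister_mulVec]
      by_cases hi : i = a
      · subst hi
        simp [ket, Matrix.mulVec, dotProduct, Pi.single_apply]
      · simp [ket, Matrix.mulVec, dotProduct, Pi.single_apply, hi]
    rw [h4, Matrix.mulVec_smul]
    rfl
  rw [estimationSteps, run_cons, run_append, run_append]
  simp only [Step.matrix, h3, run_cons, run_nil]
  rw [onRegister_mulVec]
  simp only [Equiv.prodComm_apply, Equiv.prodComm_symm, Prod.swap_prod_mk, h1 K le_rfl]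
  congr 2
  ext t
  rw [min_eq_right (Nat.le_of_lt_succ t.2)]

theorem estimationSteps_cost (K : ℕ) (A B : Matrix.unitaryGroup (Fin (K + 1)) ℂ)
    (l l' : List (Step d n Ω)) (a : Ω) (g : Ω → Prop) [DecidablePred g] :
    ((estimationSteps K A B l l' a g).map Step.cost).sum =
      (K + 1) * (l.map Step.cost).sum + K * (l'.map Step.cost).sum := by
  have h : ∀ R, (((List.range R).flatMap (groverSteps K l l' a g)).map Step.cost).sum =
      R * ((l.map Step.cost).sum + (l'.map Step.cost).sum) := by
    intro R
    induction R with
    | zero => simp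
    | succ R ih =>
      rw [List.range_succ, List.flatMap_append, List.map_append, List.sum_append, ih,
        List.flatMap_singleton]
      simp only [groverSteps, List.map_cons, List.map_append, List.sum_cons, List.sum_append,
        Step.lift_cost_sum, Step.cost]
      ring
  simp only [estimationSteps, List.map_cons, List.map_append, List.sum_cons, List.sum_append,
    Step.lift_cost_sum, h, Step.cost, List.map_nil, List.sum_nil]
  ring

/-- Amplitude estimation: with `K` Grover iterations the probability `p` of the good states of
`V |a⟩` is estimated with mean square error `O (p / K ^ 2 + 1 / K ^ 4)`. -/
theorem exists_amplitudeEstimation (K : ℕ) (l l' : List (Step d n Ω)) (a : Ω) (g : Ω → Prop)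
    [DecidablePred g] : ∃ alg : QueryAlgorithm d n,
      alg.queries = (K + 1) * (l.map Step.cost).sum + K * (l'.map Step.cost).sum ∧
      ∀ (O : Oracles d n) (V : Matrix Ω Ω ℂ), V ∈ Matrix.unitaryGroup Ω ℂ →
        (∀ v, run O l v = V *ᵥ v) → (∀ v, run O l' v = Vᴴ *ᵥ v) →
        ∑ x, (alg.output x - goodProb V a g) ^ 2 * ‖alg.finalState O x‖ ^ 2 ≤
          (Real.pi / (K + 2)) ^ 4 / 8 + 2 * (Real.pi / (K + 2)) ^ 2 * goodProb V a g := by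
  obtain ⟨f, h0, hK, hf, hf1⟩ := exists_window K
  obtain ⟨A, hA⟩ := exists_unitary_mulVec_ket (0 : Fin (K + 1)) (fun t => (f (t + 1) : ℂ)) (by
    rw [← hf1]
    exact Finset.sum_congr rfl fun t _ => by
      rw [Complex.norm_real, Real.norm_eq_abs, sq_abs])
  have hX := pathMatrix_isHermitian K
  refine ⟨⟨Ω × Fin (K + 1), (a, 0),
    estimationSteps K A (star hX.eigenvectorUnitary) l l' a g,
    fun x => (1 - hX.eigenvalues x.2) / 2⟩, estimationSteps_cost .., ?_⟩
  intro O V hV hl hl'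
  set p := goodProb V a g with hp
  have hp0 : 0 ≤ p := goodProb_nonneg V a g
  have hp1 : p ≤ 1 := goodProb_le_one hV a g
  set c := Real.cos (Real.pi / (K + 2)) with hc
  have h1 : ∀ x y, run O (estimationSteps K A (star hX.eigenvectorUnitary) l l' a g)
      (ket (a, 0)) (x, y) = (star hX.eigenvectorUnitary.1 *ᵥ
        fun t => (f (t + 1) : ℂ) * groverVec V a g (t + 1) x) y := by
    intro x y
    rw [run_estimationSteps K A _ a g O hV hl hl', hA]
    rfl
  have h2 := sum_window_deviation_le (m := 1 - 2 * p) h0 hK hf hf1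
    (sum_norm_sq_groverVec hV a g) (groverVec_recurrence hV a g) (by nlinarith)
  have h3 : ∀ x, ∑ y, (hX.eigenvalues y - (1 - 2 * p)) ^ 2 *
      ‖(star hX.eigenvectorUnitary.1 *ᵥ
        fun t => (f (t + 1) : ℂ) * groverVec V a g (t + 1) x) y‖ ^ 2 =
      ∑ t : Fin (K + 1), ‖(f (t + 2) * groverVec V a g (t + 2) x + f t * groverVec V a g t x) / 2 -
        (1 - 2 * p : ℝ) * (f (t + 1) * groverVec V a g (t + 1) x)‖ ^ 2 := by
    intro x
    rw [sum_eigenvalue_deviation]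
    refine Finset.sum_congr rfl fun t _ => ?_
    rw [pathMatrix_mulVec (fun t => (f t : ℂ) * groverVec V a g t x) (by simp [h0])
      (by simp [hK])]
  have h4 : ∑ x : Ω × Fin (K + 1), ((1 - hX.eigenvalues x.2) / 2 - p) ^ 2 *
      ‖run O (estimationSteps K A (star hX.eigenvectorUnitary) l l' a g) (ket (a, 0)) x‖ ^ 2 =
      (∑ x, ∑ t : Fin (K + 1),
        ‖(f (t + 2) * groverVec V a g (t + 2) x + f t * groverVec V a g t x) / 2 -
        (1 - 2 * p : ℝ) * (f (t + 1) * groverVec V a g (t + 1) x)‖ ^ 2) / 4 := by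
    rw [Fintype.sum_prod_type, Finset.sum_div]
    refine Finset.sum_congr rfl fun x _ => ?_
    rw [← h3, Finset.sum_div]
    refine Finset.sum_congr rfl fun y _ => ?_
    rw [h1]
    ring
  refine h4.trans_le ?_
  have h5 : 1 - c ≤ (Real.pi / (K + 2)) ^ 2 / 2 := by
    linarith [Real.one_sub_sq_div_two_le_cos (x := Real.pi / (K + 2))]
  have h6 : 0 ≤ 1 - c := by linarith [Real.cos_le_one (Real.pi / (K + 2))]
  have h7 : -1 ≤ c := Real.neg_one_le_cos _
  have h8 : 1 - c ^ 2 ≤ (Real.pi / (K + 2)) ^ 2 := by nlinarith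
  have h9 : (1 - c) ^ 2 ≤ ((Real.pi / (K + 2)) ^ 2 / 2) ^ 2 := pow_le_pow_left₀ h6 h5 2
  have h10 : (1 - c ^ 2) * (1 - (1 - 2 * p) ^ 2) ≤ (Real.pi / (K + 2)) ^ 2 * (4 * p) :=
    mul_le_mul h8 (by nlinarith) (by nlinarith) (sq_nonneg _)
  linarith

end Circuit

/-! ### Expectation values as probabilities -/

section Encoding

variable {d m : ℕ}

/-- The system register among the registers of the select oracle. -/
def systemSplit (d m : ℕ) : SelectIdx d m ≃ Fin d × (Fin (m + 1) × Fin 2 × Fin (m + 1)) where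
  toFun x := (x.2.2.1, x.1, x.2.1, x.2.2.2)
  invFun x := (x.2.1, x.2.2.1, x.1, x.2.2.2)
  left_inv _ := rfl
  right_inv _ := rfl

/-- The registers of the prepare oracle among those of the select oracle. -/
def prepareSplit (d m : ℕ) : SelectIdx d m ≃ PrepareIdx m × (Fin d × Fin (m + 1)) where
  toFun x := ((x.1, x.2.1), x.2.2)
  invFun x := (x.1.1, x.1.2, x.2)
  left_inv _ := rfl
  right_inv _ := rfl

theorem ket_eq_tensor4 [NeZero d] :
    ket ((0, 0, 0, 0) : SelectIdx d m) = tensor4 (ket 0) (ket 0) (ket 0) (ket 0) := by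
  ext ⟨a, b, c, e⟩
  simp only [ket, tensor4, Pi.single_apply, Prod.mk.injEq]
  split_ifs <;> simp_all

theorem systemSplit_mulVec (U : Matrix (Fin d) (Fin d) ℂ) (u : Fin (m + 1) → ℂ) (y : Fin 2 → ℂ)
    (v : Fin d → ℂ) (w : Fin (m + 1) → ℂ) :
    onRegister (systemSplit d m) U *ᵥ tensor4 u y v w = tensor4 u y (U *ᵥ v) w := by
  ext ⟨a, b, c, e⟩
  rw [onRegister_mulVec]
  simp only [systemSplit, tensor4, Equiv.coe_fn_mk, Equiv.coe_fn_symm_mk, Matrix.mulVec, dotProduct,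
    Finset.mul_sum, Finset.sum_mul]
  exact Finset.sum_congr rfl fun i _ => by ring

theorem prepareSplit_mulVec (U : Matrix (PrepareIdx m) (PrepareIdx m) ℂ) (u : Fin (m + 1) → ℂ)
    (y : Fin 2 → ℂ) (v : Fin d → ℂ) (w : Fin (m + 1) → ℂ) (x : SelectIdx d m) :
    (onRegister (prepareSplit d m) U *ᵥ tensor4 u y v w) x =
      (U *ᵥ tensor2 u y) (x.1, x.2.1) * v x.2.2.1 * w x.2.2.2 := by
  rw [onRegister_mulVec]
  simp only [prepareSplit, tensor4, tensor2, Equiv.coe_fn_mk, Equiv.coe_fn_symm_mk, Matrix.mulVec,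
    dotProduct, Finset.sum_mul]
  exact Finset.sum_congr rfl fun i _ => by ring

theorem onRegister_prodUnique_mulVec {Ω : Type} [Fintype Ω] (U : Matrix Ω Ω ℂ) (v : Ω → ℂ) :
    onRegister (Equiv.prodUnique Ω Unit).symm U *ᵥ v = U *ᵥ v := by
  ext x
  rw [onRegister_mulVec]
  rfl

theorem flip0_mulVec_ket_zero (k : Fin m) : flip0 k.succ *ᵥ ket 0 = ket k.succ := by
  ext x
  simp only [flip0, ket, Matrix.mulVec_single_one, Matrix.col_apply, Matrix.add_apply,
    Matrix.single_apply, Pi.single_apply]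
  by_cases hx : x = k.succ
  · subst hx; simp [(Fin.succ_ne_zero k)]
  · simp [hx, Ne.symm hx, Fin.succ_ne_zero]

theorem sum_norm_sq_proj_mulVec {P : Matrix (Fin d) (Fin d) ℂ} (hP : IsStarProjection P)
    (ψ : Fin d → ℂ) : ∑ v, ‖(P *ᵥ ψ) v‖ ^ 2 = expVal ψ P := by
  have h : star (P *ᵥ ψ) ⬝ᵥ (P *ᵥ ψ) = star ψ ⬝ᵥ (P *ᵥ ψ) := by
    have h1 : Pᴴ = P := hP.isSelfAdjoint
    have h2 : P * P = P := hP.isIdempotentElem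
    rw [Matrix.star_mulVec, h1, Matrix.dotProduct_mulVec, Matrix.vecMul_vecMul, h2,
      Matrix.dotProduct_mulVec]
  rw [expVal, ← h, dotProduct_star_self, Complex.ofReal_re]

theorem expVal_sum {ι : Type} (s : Finset ι) (ψ : Fin d → ℂ)
    (M : ι → Matrix (Fin d) (Fin d) ℂ) : expVal ψ (∑ i ∈ s, M i) = ∑ i ∈ s, expVal ψ (M i) := by
  simp only [expVal, Matrix.sum_mulVec, dotProduct_sum, Complex.re_sum]

theorem expVal_smul (ψ : Fin d → ℂ) (b : ℝ) (M : Matrix (Fin d) (Fin d) ℂ) :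
    expVal ψ ((b : ℂ) • M) = b * expVal ψ M := by
  simp [expVal, Matrix.smul_mulVec]

variable {J : ℕ} {n : Fin J → ℕ}

/-- The unitary `PREPARE⁻¹ SELECT PREPARE O_ψ` of a group. -/
def groupUnitary (O : Oracles d n) (j : Fin J) :
    Matrix (SelectIdx d (n j)) (SelectIdx d (n j)) ℂ :=
  onRegister (prepareSplit d (n j)) (O.prepare j).1ᴴ *
    (onRegister (Equiv.prodUnique _ Unit).symm (O.select j).1 *
      (onRegister (prepareSplit d (n j)) (O.prepare j).1 *
        onRegister (systemSplit d (n j)) O.state.1))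

/-- The steps that perform `groupUnitary`. -/
def groupSteps (d : ℕ) {J : ℕ} (n : Fin J → ℕ) (j : Fin J) : List (Step d n (SelectIdx d (n j))) :=
  [.queryState false _ (systemSplit d (n j)), .queryPrepare j false _ (prepareSplit d (n j)),
    .querySelect j false Unit (Equiv.prodUnique _ Unit).symm,
    .queryPrepare j true _ (prepareSplit d (n j))]

/-- The steps that perform the inverse of `groupUnitary`. -/
def groupStepsInv (d : ℕ) {J : ℕ} (n : Fin J → ℕ) (j : Fin J) :
    List (Step d n (SelectIdx d (n j))) :=
  [.queryPrepare j false _ (prepareSplit d (n j)),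
    .querySelect j true Unit (Equiv.prodUnique _ Unit).symm,
    .queryPrepare j true _ (prepareSplit d (n j)), .queryState true _ (systemSplit d (n j))]

theorem groupUnitary_mem (O : Oracles d n) (j : Fin J) :
    groupUnitary O j ∈ Matrix.unitaryGroup (SelectIdx d (n j)) ℂ :=
  mul_mem (onRegister_mem_unitaryGroup _ (Unitary.star_mem (O.prepare j).2))
    (mul_mem (onRegister_mem_unitaryGroup _ (O.select j).2)
      (mul_mem (onRegister_mem_unitaryGroup _ (O.prepare j).2)
        (onRegister_mem_unitaryGroup _ O.state.2)))

theorem run_groupSteps (O : Oracles d n) (j : Fin J) (v : SelectIdx d (n j) → ℂ) :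
    run O (groupSteps d n j) v = groupUnitary O j *ᵥ v := by
  simp only [groupSteps, groupUnitary, run_cons, run_nil, Step.queryState_matrix,
    Step.querySelect_matrix, Step.queryPrepare_matrix, orInv_true, orInv_false,
    ← Matrix.mulVec_mulVec]

theorem run_groupStepsInv (O : Oracles d n) (j : Fin J) (v : SelectIdx d (n j) → ℂ) :
    run O (groupStepsInv d n j) v = (groupUnitary O j)ᴴ *ᵥ v := by
  simp only [groupStepsInv, groupUnitary, run_cons, run_nil, Step.queryState_matrix,
    Step.querySelect_matrix, Step.queryPrepare_matrix, orInv_true, orInv_false,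
    ← Matrix.mulVec_mulVec, Matrix.conjTranspose_mul, onRegister_conjTranspose,
    Matrix.conjTranspose_conjTranspose]

variable [NeZero d] {O : Oracles d n} {ψ : Fin d → ℂ} {β : ∀ j, Fin (n j) → ℝ}
  {P : ∀ j, Fin (n j) → Matrix (Fin d) (Fin d) ℂ}

/-- The amplitudes of the state that the prepare oracle prepares. -/
def prepareAmp (β : ∀ j, Fin (n j) → ℝ) (j : Fin J) (k : Fin (n j)) : ℝ :=
  |β j k| ^ (1 / 4 : ℝ) / (√2 * √(sqrtSum (β j)))

theorem sqrtSum_nonneg {m : ℕ} (b : Fin m → ℝ) : 0 ≤ sqrtSum b :=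
  Finset.sum_nonneg fun _ _ => Real.sqrt_nonneg _

theorem two_mul_prepareAmp_sq (β : ∀ j, Fin (n j) → ℝ) (j : Fin J) (k : Fin (n j)) :
    2 * prepareAmp β j k ^ 2 = √|β j k| / sqrtSum (β j) := by
  have h : (|β j k| ^ (1 / 4 : ℝ)) ^ 2 = √|β j k| := by
    rw [← Real.rpow_natCast, ← Real.rpow_mul (abs_nonneg _), Real.sqrt_eq_rpow]
    norm_num
  rw [prepareAmp, div_pow, mul_pow, h, Real.sq_sqrt zero_le_two, Real.sq_sqrt (sqrtSum_nonneg _)]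
  rw [mul_div_assoc', mul_div_mul_left _ _ two_ne_zero]

/-- Since `φ` starts in `|0⟩`, the select oracle copies the index register into it. -/
theorem select_prepare_mulVec_ket (hO : O.Encodes ψ β P) (j : Fin J) :
    onRegister (Equiv.prodUnique _ Unit).symm (O.select j).1 *ᵥ
      (onRegister (prepareSplit d (n j)) (O.prepare j).1 *ᵥ
        (onRegister (systemSplit d (n j)) O.state.1 *ᵥ ket (0, 0, 0, 0))) =
      ∑ k : Fin (n j), ∑ y : Fin 2, (prepareAmp β j k : ℂ) •
        tensor4 (ket k.succ) (pauliZ *ᵥ ket y) (((1 - (2 : ℂ) • P j k) ^ (y : ℕ)) *ᵥ ψ)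
          (ket k.succ) := by
  have h1 : onRegister (prepareSplit d (n j)) (O.prepare j).1 *ᵥ
      tensor4 (ket 0) (ket 0) ψ (ket 0) = ∑ k : Fin (n j), ∑ y : Fin 2,
        (prepareAmp β j k : ℂ) • tensor4 (ket k.succ) (ket y) ψ (ket 0) := by
    ext x
    rw [prepareSplit_mulVec, hO.prepare_zero]
    simp only [Finset.sum_apply, Pi.smul_apply, smul_eq_mul, tensor2, tensor4, Finset.sum_mul,
      prepareAmp]
    exact Finset.sum_congr rfl fun k _ => Finset.sum_congr rfl fun y _ => by ring
  rw [ket_eq_tensor4, systemSplit_mulVec, hO.state_zero, h1, onRegister_prodUnique_mulVec]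
  simp only [Matrix.mulVec_sum, Matrix.mulVec_smul]
  refine Finset.sum_congr rfl fun k _ => Finset.sum_congr rfl fun y _ => ?_
  rw [hO.select_apply j k y ψ 0 (Or.inl rfl), flip0_mulVec_ket_zero]

/-- The first column of the prepare oracle, which is the first row of its inverse. -/
theorem prepare_apply_zero (hO : O.Encodes ψ β P) (j : Fin J) (i : PrepareIdx (n j)) :
    (O.prepare j).1 i (0, 0) =
      (Fin.cons 0 (fun k => (prepareAmp β j k : ℂ)) : Fin (n j + 1) → ℂ) i.1 := by
  have h : tensor2 (ket (0 : Fin (n j + 1))) (ket (0 : Fin 2)) = ket (0, 0) := by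
    ext ⟨a, b⟩
    simp only [ket, tensor2, Pi.single_apply, Prod.mk.injEq]
    split_ifs <;> simp_all
  have h1 := congrFun (hO.prepare_zero j) i
  rw [h, ket, Matrix.mulVec_single_one, Matrix.col_apply] at h1
  rw [h1]
  obtain ⟨a, b⟩ := i
  refine Fin.cases ?_ (fun k => ?_) a
  · simp [tensor2, ket, Pi.single_apply, (Fin.succ_ne_zero _).symm]
  · simp [tensor2, ket, Pi.single_apply, prepareAmp]
    fin_cases b <;> simp

/-- The good part of the final state: the two prepare oracles turn the amplitudes into
`√|β j k| / sqrtSum (β j)`, and the sum over `y` turns the reflection into the projector. -/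
theorem groupUnitary_mulVec_apply (hO : O.Encodes ψ β P) (j : Fin J) (v : Fin d)
    (f : Fin (n j + 1)) :
    (groupUnitary O j *ᵥ ket (0, 0, 0, 0)) (0, 0, v, f) =
      (Fin.cons 0 (fun k => ((√|β j k| / sqrtSum (β j) : ℝ) : ℂ) * (P j k *ᵥ ψ) v) :
        Fin (n j + 1) → ℂ) f := by
  simp only [groupUnitary, ← Matrix.mulVec_mulVec]
  rw [select_prepare_mulVec_ket hO, onRegister_mulVec]
  simp only [Matrix.mulVec, dotProduct, prepareSplit, Equiv.coe_fn_mk, Equiv.coe_fn_symm_mk,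
    Matrix.conjTranspose_apply, prepare_apply_zero hO]
  rw [Fintype.sum_prod_type, Fin.sum_univ_succ]
  simp only [Fin.cons_zero, Fin.cons_succ, star_zero, zero_mul, Finset.sum_const_zero, zero_add]
  have h1 : ∀ (k : Fin (n j)) (y : Fin 2),
      (∑ k' : Fin (n j), ∑ y' : Fin 2, (prepareAmp β j k' : ℂ) •
        tensor4 (ket k'.succ) (pauliZ *ᵥ ket y') (((1 - (2 : ℂ) • P j k') ^ (y' : ℕ)) *ᵥ ψ)
          (ket k'.succ)) (k.succ, y, v, f) =
      (prepareAmp β j k : ℂ) * ((-1) ^ (y : ℕ) * (((1 - (2 : ℂ) • P j k) ^ (y : ℕ)) *ᵥ ψ) v *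
        ket k.succ f) := by
    intro k y
    simp only [Finset.sum_apply, Pi.smul_apply, smul_eq_mul, tensor4]
    rw [Finset.sum_eq_single k]
    · fin_cases y <;> simp [pauliZ, ket, Matrix.mulVec, dotProduct]
    · intro k' _ hk
      simp [ket, Pi.single_apply, hk.symm]
    · simp
  have h2 : ∀ k : Fin (n j), ∑ y : Fin 2, star (prepareAmp β j k : ℂ) *
      ((prepareAmp β j k : ℂ) * ((-1) ^ (y : ℕ) * (((1 - (2 : ℂ) • P j k) ^ (y : ℕ)) *ᵥ ψ) v *
        ket k.succ f)) =
      ((√|β j k| / sqrtSum (β j) : ℝ) : ℂ) * (P j k *ᵥ ψ) v * ket k.succ f := by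
    intro k
    rw [← two_mul_prepareAmp_sq, Fin.sum_univ_two]
    simp only [Fin.val_zero, Fin.val_one, pow_zero, pow_one, Matrix.one_mulVec, Matrix.sub_mulVec,
      Matrix.smul_mulVec, Pi.sub_apply, Pi.smul_apply, smul_eq_mul, RCLike.star_def,
      Complex.conj_ofReal]
    push_cast
    ring
  refine (Finset.sum_congr rfl fun k _ => Finset.sum_congr rfl fun y _ =>
    congrArg _ (h1 k y)).trans ((Finset.sum_congr rfl fun k _ => h2 k).trans ?_)
  refine Fin.cases ?_ (fun k => ?_) f
  · simp [ket, (Fin.succ_ne_zero _).symm]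
  · simp only [ket, Pi.single_apply, Fin.succ_inj, Fin.cons_succ, mul_ite, mul_one, mul_zero,
      Finset.sum_ite_eq, Finset.mem_univ, if_true]
    rfl

/-- The coefficients are squared in the norm, which removes the square roots. -/
theorem goodProb_groupUnitary (hO : O.Encodes ψ β P) (hP : ∀ j k, IsStarProjection (P j k))
    (j : Fin J) : goodProb (groupUnitary O j) (0, 0, 0, 0) (fun x => x.1 = 0 ∧ x.2.1 = 0) =
      (∑ k, |β j k| * expVal ψ (P j k)) / sqrtSum (β j) ^ 2 := by
  have h1 : goodProb (groupUnitary O j) (0, 0, 0, 0) (fun x => x.1 = 0 ∧ x.2.1 = 0) =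
      ∑ v, ∑ f, ‖(groupUnitary O j *ᵥ ket (0, 0, 0, 0)) (0, 0, v, f)‖ ^ 2 := by
    rw [goodProb, Fintype.sum_prod_type, Finset.sum_eq_single 0, Fintype.sum_prod_type,
      Finset.sum_eq_single 0, Fintype.sum_prod_type]
    · simp
    all_goals simp +contextual
  rw [h1, Finset.sum_comm, Fin.sum_univ_succ, Finset.sum_div]
  simp only [groupUnitary_mulVec_apply hO, Fin.cons_zero, Fin.cons_succ, norm_zero, norm_mul,
    mul_pow, ← Finset.mul_sum, sum_norm_sq_proj_mulVec (hP _ _), Complex.norm_real,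
    Real.norm_eq_abs, sq_abs, div_pow, Real.sq_sqrt (abs_nonneg _)]
  simp [div_mul_eq_mul_div]

/-- The sign of the coefficients `b` of a group, provided that they all have the same sign. -/
def groupSign {m : ℕ} (b : Fin m → ℝ) : ℝ :=
  open Classical in if ∀ k, 0 ≤ b k then 1 else -1

theorem groupSign_mul_abs {m : ℕ} {b : Fin m → ℝ} (hb : (∀ k, 0 ≤ b k) ∨ ∀ k, b k ≤ 0)
    (k : Fin m) : groupSign b * |b k| = b k := by
  rw [groupSign]
  split_ifs with h
  · rw [one_mul, abs_of_nonneg (h k)]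
  · rw [abs_of_nonpos (hb.resolve_left h k)]
    ring

theorem abs_groupSign {m : ℕ} (b : Fin m → ℝ) : |groupSign b| = 1 := by
  rw [groupSign]
  split_ifs <;> simp

omit [NeZero d] in
theorem expVal_nonneg {P : Matrix (Fin d) (Fin d) ℂ} (hP : IsStarProjection P)
    (ψ : Fin d → ℂ) : 0 ≤ expVal ψ P := by
  rw [← sum_norm_sq_proj_mulVec hP]
  positivity

omit [NeZero d] in
/-- The expectation value of a group has the sign of its coefficients. -/
theorem expVal_groupOp (hP : ∀ j k, IsStarProjection (P j k))
    (hβ : ∀ j, (∀ k, 0 ≤ β j k) ∨ ∀ k, β j k ≤ 0) (j : Fin J) :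
    expVal ψ (groupOp β P j) = groupSign (β j) * |expVal ψ (groupOp β P j)| ∧
      |expVal ψ (groupOp β P j)| = ∑ k, |β j k| * expVal ψ (P j k) := by
  have h1 : expVal ψ (groupOp β P j) = groupSign (β j) * ∑ k, |β j k| * expVal ψ (P j k) := by
    rw [groupOp, expVal_sum, Finset.mul_sum]
    exact Finset.sum_congr rfl fun k _ => by
      rw [expVal_smul, ← mul_assoc, groupSign_mul_abs (hβ j)]
  have h2 : |expVal ψ (groupOp β P j)| = ∑ k, |β j k| * expVal ψ (P j k) := by
    rw [h1, abs_mul, abs_groupSign, one_mul]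
    exact abs_of_nonneg (Finset.sum_nonneg fun k _ =>
      mul_nonneg (abs_nonneg _) (expVal_nonneg (hP j k) ψ))
  exact ⟨by rw [h2]; exact h1, h2⟩

end Encoding

/-! ### Majority votes -/

section Majority

open Classical in
/-- A Chernoff bound: if each of finitely many independent events with indices in `s` has
probability at most `1 / 16`, then at least half of them occur with probability at
most `2 ^ (-#s)`. -/
theorem sum_prod_majority_le {I : Type} [Fintype I] [DecidableEq I] {Ω : I → Type}
    [∀ i, Fintype (Ω i)]
    {w : ∀ i, Ω i → ℝ} (hw0 : ∀ i x, 0 ≤ w i x) (hw1 : ∀ i, ∑ x, w i x = 1)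
    (B : ∀ i, Ω i → Prop) (s : Finset I) (hB : ∀ i ∈ s, ∑ x with B i x, w i x ≤ 1 / 16) :
    ∑ x : ∀ i, Ω i with s.card ≤ 2 * (s.filter fun i => B i (x i)).card, ∏ i, w i (x i) ≤
      (1 / 2) ^ s.card := by
  -- The indicator of the event is at most `4 ^ (2 * k - #s)`, where `k` of the events occur, and
  -- the expectation of `16 ^ k` is a product of factors at most `1 + 15 / 16`.
  have h1 : ∀ x : ∀ i, Ω i,
      (if s.card ≤ 2 * (s.filter fun i => B i (x i)).card then ∏ i, w i (x i) else 0) ≤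
      (∏ i, w i (x i) * if i ∈ s ∧ B i (x i) then 16 else 1) * (1 / 4) ^ s.card := by
    intro x
    have h2 : (∏ i, if i ∈ s ∧ B i (x i) then (16 : ℝ) else 1) =
        4 ^ (2 * (s.filter fun i => B i (x i)).card) := by
      rw [← Finset.prod_filter, Finset.prod_const, pow_mul, ← Finset.filter_filter]
      norm_num
    have h3 : 0 ≤ ∏ i, w i (x i) := Finset.prod_nonneg fun i _ => hw0 i _
    rw [Finset.prod_mul_distrib, h2]
    split_ifs with h
    · rw [mul_assoc]
      refine le_mul_of_one_le_right h3 ?_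
      rw [one_div, inv_pow, ← div_eq_mul_inv, one_le_div (by positivity)]
      exact pow_le_pow_right₀ (by norm_num) h
    · positivity
  rw [Finset.sum_filter]
  refine (Finset.sum_le_sum fun x _ => h1 x).trans ?_
  have h4 := Finset.prod_univ_sum (fun i => (Finset.univ : Finset (Ω i)))
    (fun i y => w i y * if i ∈ s ∧ B i y then (16 : ℝ) else 1)
  rw [Fintype.piFinset_univ] at h4
  rw [← Finset.sum_mul, ← h4]
  have h5 : ∀ i, ∑ y, w i y * (if i ∈ s ∧ B i y then (16 : ℝ) else 1) ≤ if i ∈ s then 2 else 1 := by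
    intro i
    by_cases hi : i ∈ s
    · have h6 : ∀ y, w i y * (if i ∈ s ∧ B i y then (16 : ℝ) else 1) =
          w i y + 15 * if B i y then w i y else 0 := by
        intro y
        by_cases hy : B i y
        · simp only [hi, hy, and_self, if_true]; ring
        · simp [hi, hy]
      have h7 := hB i hi
      rw [Finset.sum_filter] at h7
      simp only [h6]
      rw [Finset.sum_add_distrib, hw1, ← Finset.mul_sum, if_pos hi]
      linarith
    · simp [hi, hw1]
  have h8 := Finset.prod_le_prod (s := Finset.univ) (fun i _ => Finset.sum_nonneg fun y _ =>
    mul_nonneg (hw0 i y) (by split_ifs <;> norm_num)) fun i _ => h5 i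
  rw [← Finset.prod_filter, Finset.prod_const, Finset.filter_mem_eq_inter, Finset.univ_inter] at h8
  refine (mul_le_mul_of_nonneg_right h8 (by positivity)).trans_eq ?_
  rw [← mul_pow]
  norm_num

open Classical in
/-- A number to which more than half of the estimates `e` are `τ`-close, if there is one. -/
def majority {R : ℕ} (e : Fin R → ℝ) (τ : ℝ) : ℝ :=
  if h : ∃ v, R < 2 * (Finset.univ.filter fun r => |e r - v| ≤ τ).card then h.choose else 0

theorem abs_majority_sub_le {R : ℕ} {e : Fin R → ℝ} {τ p : ℝ}
    (h : R < 2 * (Finset.univ.filter fun r => |e r - p| ≤ τ).card) :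
    |majority e τ - p| ≤ 2 * τ := by
  classical
  have h1 : ∃ v, R < 2 * (Finset.univ.filter fun r => |e r - v| ≤ τ).card := ⟨p, h⟩
  have h2 : R < 2 * (Finset.univ.filter fun r => |e r - majority e τ| ≤ τ).card := by
    rw [majority, dif_pos h1]
    convert h1.choose_spec
  -- Two majorities have a common member.
  obtain ⟨r, hr⟩ : ((Finset.univ.filter fun r => |e r - majority e τ| ≤ τ) ∩
      (Finset.univ.filter fun r => |e r - p| ≤ τ)).Nonempty := by
    rw [← Finset.card_pos]
    have h3 := Finset.card_union_add_card_inter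
      (Finset.univ.filter fun r => |e r - majority e τ| ≤ τ)
      (Finset.univ.filter fun r => |e r - p| ≤ τ)
    have h4 := Finset.card_le_univ ((Finset.univ.filter fun r => |e r - majority e τ| ≤ τ) ∪
      (Finset.univ.filter fun r => |e r - p| ≤ τ))
    rw [Fintype.card_fin] at h4
    omega
  simp only [Finset.mem_inter, Finset.mem_filter, Finset.mem_univ, true_and] at hr
  rw [abs_sub_comm] at hr
  linarith [abs_sub_le (majority e τ) (e r) p]

variable {d J : ℕ} {n : Fin J → ℕ}

/-- Chebyshev's inequality for the output of an algorithm. -/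
theorem QueryAlgorithm.failureProb_le_of_sum_le (alg : QueryAlgorithm d n) (O : Oracles d n)
    {a ε q : ℝ} (hε : 0 < ε)
    (h : ∑ x, (alg.output x - a) ^ 2 * ‖alg.finalState O x‖ ^ 2 ≤ ε ^ 2 * q) :
    alg.failureProb O a ε ≤ q := by
  classical
  rw [← mul_le_mul_iff_right₀ (pow_pos hε 2)]
  refine le_trans ?_ h
  rw [failureProb, Finset.mul_sum]
  refine (Finset.sum_le_sum fun x hx => mul_le_mul_of_nonneg_right (?_ : ε ^ 2 ≤
    (alg.output x - a) ^ 2) (sq_nonneg _)).trans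
    (Finset.sum_le_sum_of_subset_of_nonneg (Finset.filter_subset _ _) fun x _ _ => by positivity)
  rw [← sq_abs (alg.output x - a)]
  exact pow_le_pow_left₀ hε.le (Finset.mem_filter.1 hx).2.le 2

/-- `J` numbers are estimated by algorithms with failure probability at most `1 / 16`. Then `R`
independent runs of each and majority votes estimate a linear combination of the numbers with
failure probability at most `J * 2 ^ (-R)`. -/
theorem exists_linearCombination_estimate (alg : Fin J → QueryAlgorithm d n) (c : Fin J → ℝ)
    (τ : ℝ) (R : ℕ) : ∃ alg' : QueryAlgorithm d n,
      alg'.queries = R * ∑ j, (alg j).queries ∧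
      ∀ (O : Oracles d n) (p : Fin J → ℝ), (∀ j, (alg j).failureProb O (p j) τ ≤ 1 / 16) →
        ∀ ε, (∑ j, |c j|) * (2 * τ) ≤ ε →
          alg'.failureProb O (∑ j, c j * p j) ε ≤ J * (1 / 2) ^ R := by
  classical
  set out : (∀ i : Fin J × Fin R, (alg i.1).Ω) → ℝ := fun x =>
    ∑ j, c j * majority (fun r => (alg j).output (x (j, r))) τ with hout
  refine ⟨parallel (fun i : Fin J × Fin R => alg i.1) out, ?_, ?_⟩
  · rw [parallel_queries, Fintype.sum_prod_type, Finset.mul_sum]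
    simp
  intro O p hp ε hε
  set B : ∀ i : Fin J × Fin R, (alg i.1).Ω → Prop := fun i x =>
    τ < |(alg i.1).output x - p i.1| with hBdef
  set s : Fin J → Finset (Fin J × Fin R) := fun j =>
    Finset.univ.map ⟨fun r => (j, r), fun _ _ h => (Prod.mk.inj h).2⟩ with hs
  have hcard : ∀ j, (s j).card = R := fun j => by simp [hs]
  set w : ∀ i : Fin J × Fin R, (alg i.1).Ω → ℝ := fun i x => ‖(alg i.1).finalState O x‖ ^ 2
  have h1 : ∀ j, ∑ x : ∀ i : Fin J × Fin R, (alg i.1).Ω with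
      (s j).card ≤ 2 * ((s j).filter fun i => B i (x i)).card, ∏ i, w i (x i) ≤
      (1 / 2) ^ R := by
    intro j
    refine (sum_prod_majority_le (w := w) (fun i x => sq_nonneg _)
      (fun i => (alg i.1).sum_norm_sq_finalState O) B (s j) fun i _ => hp i.1).trans_eq ?_
    rw [hcard]
  -- The output is good unless for some group at least half of the runs fail.
  have h2 : ∀ x : ∀ i : Fin J × Fin R, (alg i.1).Ω, ε < |out x - ∑ j, c j * p j| →
      ∃ j, (s j).card ≤ 2 * ((s j).filter fun i => B i (x i)).card := by
    intro x hx
    by_contra! h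
    refine absurd hx (not_lt.2 (le_trans ?_ hε))
    rw [hout, ← Finset.sum_sub_distrib, Finset.sum_mul]
    refine (Finset.abs_sum_le_sum_abs _ _).trans (Finset.sum_le_sum fun j _ => ?_)
    rw [← mul_sub, abs_mul]
    refine mul_le_mul_of_nonneg_left (abs_majority_sub_le ?_) (abs_nonneg _)
    have h3 := h j
    rw [hcard, hs, Finset.filter_map, Finset.card_map] at h3
    have h4 := Finset.card_filter_add_card_filter_not (s := (Finset.univ : Finset (Fin R)))
      fun r => |(alg j).output (x (j, r)) - p j| ≤ τ
    simp only [not_le, Finset.card_univ, Fintype.card_fin] at h4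
    have h5 : (Finset.univ.filter ((fun i => B i (x i)) ∘
        (⟨fun r => (j, r), fun _ _ h => (Prod.mk.inj h).2⟩ : Fin R ↪ Fin J × Fin R))).card =
        (Finset.univ.filter fun r => τ < |(alg j).output (x (j, r)) - p j|).card := rfl
    omega
  have h6 : (parallel (fun i : Fin J × Fin R => alg i.1) out).failureProb O (∑ j, c j * p j) ε =
      ∑ x : ∀ i : Fin J × Fin R, (alg i.1).Ω with ε < |out x - ∑ j, c j * p j|,
        ∏ i, w i (x i) := by
    refine Finset.sum_congr rfl fun x _ => ?_
    refine (congrArg (fun z : ℂ => ‖z‖ ^ 2) (parallel_finalState _ out O x)).trans ?_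
    simp only [norm_prod, Finset.prod_pow, w]
  rw [h6]
  calc ∑ x : ∀ i : Fin J × Fin R, (alg i.1).Ω with ε < |out x - ∑ j, c j * p j|, ∏ i, w i (x i)
      ≤ ∑ j, ∑ x : ∀ i : Fin J × Fin R, (alg i.1).Ω with
          (s j).card ≤ 2 * ((s j).filter fun i => B i (x i)).card, ∏ i, w i (x i) := by
        simp only [Finset.sum_filter]
        rw [Finset.sum_comm]
        refine Finset.sum_le_sum fun x _ => ?_
        have h7 : 0 ≤ ∏ i, w i (x i) := Finset.prod_nonneg fun i _ => sq_nonneg _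
        have h8 : ∀ j, 0 ≤ if (s j).card ≤ 2 * ((s j).filter fun i => B i (x i)).card then
            ∏ i, w i (x i) else 0 := fun j => by split_ifs <;> simp [h7]
        by_cases hx : ε < |out x - ∑ j, c j * p j|
        · obtain ⟨j, hj⟩ := h2 x hx
          rw [if_pos hx]
          refine le_trans ?_ (Finset.single_le_sum (fun j _ => h8 j) (Finset.mem_univ j))
          rw [if_pos hj]
        · rw [if_neg hx]
          exact Finset.sum_nonneg fun j _ => h8 j
    _ ≤ ∑ _j : Fin J, (1 / 2) ^ R := Finset.sum_le_sum fun j _ => h1 j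
    _ = J * (1 / 2) ^ R := by simp

end Majority

/-! ### Query complexity -/

section Complexity

theorem upperBound_pos (μ : ℕ) : 0 < upperBound μ := by
  refine pow_pos (Real.sin_pos_of_pos_of_lt_pi (by positivity) ?_) 2
  exact div_lt_self Real.pi_pos (by linarith [(Nat.cast_nonneg μ : (0 : ℝ) ≤ μ)])

theorem upperBound_le_one (μ : ℕ) : upperBound μ ≤ 1 := Real.sin_sq_le_one _

theorem sqrtSum_pos {m : ℕ} {b : Fin m → ℝ} (hb : ∃ k, b k ≠ 0) : 0 < sqrtSum b := by
  obtain ⟨k, hk⟩ := hb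
  exact Finset.sum_pos' (fun _ _ => Real.sqrt_nonneg _)
    ⟨k, Finset.mem_univ _, Real.sqrt_pos.2 (abs_pos.2 hk)⟩

/-- The mean square error of amplitude estimation with window angle `α` is small enough for
precision `η / 2` with failure probability `1 / 16`. -/
theorem meanSquare_le {p P η α : ℝ} (hη : 0 < η) (hP : η ≤ P) (hp : p ≤ P) (hα : 0 ≤ α)
    (h : 16 * √P * α ≤ η) : α ^ 4 / 8 + 2 * α ^ 2 * p ≤ (η / 2) ^ 2 * (1 / 16) := by
  have hP0 : 0 < P := hη.trans_le hP
  have h1 : 256 * P * α ^ 2 ≤ η ^ 2 := by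
    have := pow_le_pow_left₀ (by positivity) h 2
    rw [mul_pow, mul_pow, Real.sq_sqrt hP0.le] at this
    linarith
  have h2 : 256 * α ^ 2 ≤ η := by
    have h3 : 256 * P * α ^ 2 ≤ η * P := h1.trans (by nlinarith)
    exact le_of_mul_le_mul_right (by linarith) hP0
  have h4 : (256 * α ^ 2) ^ 2 ≤ η ^ 2 := pow_le_pow_left₀ (by positivity) h2 2
  have h5 : α ^ 2 * p ≤ α ^ 2 * P := mul_le_mul_of_nonneg_left hp (sq_nonneg _)
  nlinarith [sq_nonneg η]

variable {d J : ℕ} [NeZero d] {n : Fin J → ℕ}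

/-- The expectation value of a single group, divided by `sqrtSum (β j) ^ 2`, is estimated to
precision `η / 2` with `O (√P / η)` queries if it is at most `P` and `η ≤ P ≤ 1`. -/
theorem exists_group_estimate (β : ∀ j, Fin (n j) → ℝ) (j : Fin J) {P η : ℝ} (hη : 0 < η)
    (hP : η ≤ P) (hP1 : P ≤ 1) (hβ : ∀ j, (∀ k, 0 ≤ β j k) ∨ ∀ k, β j k ≤ 0) :
    ∃ alg : QueryAlgorithm d n, (alg.queries : ℝ) ≤ 524 * (√P / η) ∧
      ∀ (Pr : ∀ j, Fin (n j) → Matrix (Fin d) (Fin d) ℂ) (ψ : Fin d → ℂ) (O : Oracles d n),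
        (∀ j k, IsStarProjection (Pr j k)) → O.Encodes ψ β Pr →
        |expVal ψ (groupOp β Pr j)| / sqrtSum (β j) ^ 2 ≤ P →
        alg.failureProb O (|expVal ψ (groupOp β Pr j)| / sqrtSum (β j) ^ 2) (η / 2) ≤ 1 / 16 := by
  have hP0 : 0 < P := hη.trans_le hP
  -- The window angle is `π / (K + 2)`, at most `4 / K`, and has to be at most `η / (16 * √P)`.
  set K := ⌈64 * (√P / η)⌉₊ with hK
  obtain ⟨alg, hq, halg⟩ := exists_amplitudeEstimation K (groupSteps d n j) (groupStepsInv d n j)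
    (0, 0, 0, 0) fun x => x.1 = 0 ∧ x.2.1 = 0
  refine ⟨alg, ?_, fun Pr ψ O hPr hO hp => ?_⟩
  -- The rounding in `K` and the initial use of `V` are absorbed since `√P / η ≥ 1`.
  · have h1 : 1 ≤ √P / η := by
      rw [one_le_div hη]
      refine hP.trans (Real.le_sqrt_of_sq_le ?_)
      nlinarith
    have h2 : (K : ℝ) ≤ 64 * (√P / η) + 1 := (Nat.ceil_lt_add_one (by positivity)).le
    have h3 : ((groupSteps d n j).map Step.cost).sum = 4 := rfl
    have h4 : ((groupStepsInv d n j).map Step.cost).sum = 4 := rfl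
    rw [hq, h3, h4]
    push_cast
    linarith
  · refine alg.failureProb_le_of_sum_le O (half_pos hη) ?_
    have h1 := halg O _ (groupUnitary_mem O j) (run_groupSteps O j) (run_groupStepsInv O j)
    rw [goodProb_groupUnitary hO hPr, ← (expVal_groupOp hPr hβ j).2] at h1
    refine h1.trans (meanSquare_le hη hP hp (by positivity) ?_)
    have h2 : 64 * (√P / η) ≤ K := Nat.le_ceil _
    rw [← mul_div_assoc, div_le_iff₀ (by positivity)]
    rw [← mul_div_assoc, div_le_iff₀ hη] at h2
    nlinarith [Real.pi_le_four, Real.sqrt_nonneg P]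

omit [NeZero d] in
theorem expVal_sum_groupOp {β : ∀ j, Fin (n j) → ℝ}
    {P : ∀ j, Fin (n j) → Matrix (Fin d) (Fin d) ℂ} {ψ : Fin d → ℂ}
    (hP : ∀ j k, IsStarProjection (P j k)) (hβ : ∀ j, (∀ k, 0 ≤ β j k) ∨ ∀ k, β j k ≤ 0)
    (hβ0 : ∀ j, ∃ k, β j k ≠ 0) :
    expVal ψ (∑ j, groupOp β P j) = ∑ j, groupSign (β j) * sqrtSum (β j) ^ 2 *
      (|expVal ψ (groupOp β P j)| / sqrtSum (β j) ^ 2) := by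
  rw [expVal_sum]
  refine Finset.sum_congr rfl fun j _ => ?_
  rw [mul_assoc, mul_div_cancel₀ _ (pow_pos (sqrtSum_pos (hβ0 j)) 2).ne']
  exact (expVal_groupOp hP hβ j).1

/-- The number of repetitions is logarithmic: since `δ'` is bounded away from `1`, so is
`log (J / δ')` from `0`, and rounding up costs only a constant factor. -/
theorem exists_repetitions {J : ℕ} [NeZero J] {δ' δ₁ : ℝ} (h0 : 0 < δ') (h1 : δ' ≤ δ₁)
    (hδ₁ : δ₁ < 1) : 0 < Real.log (J / δ') ∧ ∃ R : ℕ, J * (1 / 2 : ℝ) ^ R ≤ δ' ∧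
      (R : ℝ) ≤ (1 / Real.log 2 + 1 / Real.log (1 / δ₁)) * Real.log (J / δ') := by
  have hJ : (1 : ℝ) ≤ J := by exact_mod_cast NeZero.one_le
  have hδ : 0 < δ₁ := h0.trans_le h1
  have h2 : 0 < Real.log (1 / δ₁) := Real.log_pos (by rw [lt_div_iff₀ hδ]; linarith)
  have h3 : Real.log (1 / δ₁) ≤ Real.log (J / δ') :=
    Real.log_le_log (by positivity) (div_le_div₀ (by linarith) hJ h0 h1)
  have h4 : 0 < Real.log 2 := Real.log_pos one_lt_two
  have h5 : 0 < Real.log (J / δ') := h2.trans_le h3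
  refine ⟨h5, ⌈Real.log (J / δ') / Real.log 2⌉₊, ?_, ?_⟩
  · have h6 := Nat.le_ceil (Real.log (J / δ') / Real.log 2)
    rw [div_le_iff₀ h4, ← Real.log_pow, Real.log_le_log_iff (by positivity) (by positivity),
      div_le_iff₀ h0] at h6
    rw [one_div, inv_pow, ← div_eq_mul_inv, div_le_iff₀ (by positivity)]
    linarith
  · refine (Nat.ceil_lt_add_one (by positivity)).le.trans ?_
    have h7 : 1 ≤ 1 / Real.log (1 / δ₁) * Real.log (J / δ') := by
      rw [one_div, inv_mul_eq_div, one_le_div h2]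
      exact h3
    have h8 : Real.log (J / δ') / Real.log 2 = 1 / Real.log 2 * Real.log (J / δ') := by ring
    rw [h8, add_mul]
    linarith

/-- The precision demanded of each group, compared with the factor of the query bound: a large
ratio of `ε` to the norm forces `|δ j|` to be small compared with `P j`. -/
theorem inv_min_le {ι : Type} [Finite ι] {P δ : ι → ℝ} {C B ε : ℝ} (hC : 0 < C) (hB : 0 < B)
    (hε : 0 < ε) (hP : ∀ j, 0 < P j) (hδ : ∀ j, δ j ∈ Set.Ico (-P j) 0)
    (h : ε ≤ C * (B * ⨅ j, P j ^ 2 / |δ j|)) (i : ι) :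
    (min (ε / B) (C * P i))⁻¹ ≤ B / ε * ⨆ j, P j / |δ j| := by
  have hδ0 : 0 < |δ i| := abs_pos.2 (hδ i).2.ne
  have h1 : P i / |δ i| ≤ ⨆ j, P j / |δ j| := le_ciSup (f := fun j => P j / |δ j|)
    (Set.finite_range _).bddAbove i
  have h2 : ⨅ j, P j ^ 2 / |δ j| ≤ P i ^ 2 / |δ i| := ciInf_le (f := fun j => P j ^ 2 / |δ j|)
    (Set.finite_range _).bddBelow i
  refine le_trans ?_ (mul_le_mul_of_nonneg_left h1 (by positivity))
  have h3 : 1 ≤ P i / |δ i| := by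
    rw [one_le_div hδ0, abs_of_neg (hδ i).2]
    linarith [(hδ i).1]
  have h4 : ε ≤ C * (B * (P i ^ 2 / |δ i|)) :=
    h.trans (mul_le_mul_of_nonneg_left (mul_le_mul_of_nonneg_left h2 hB.le) hC.le)
  rcases min_cases (ε / B) (C * P i) with ⟨h5, -⟩ | ⟨h5, -⟩ <;> rw [h5]
  · rw [inv_div]
    exact le_mul_of_one_le_right (by positivity) h3
  · have hPi := hP i
    rw [inv_eq_one_div, div_le_iff₀ (by positivity)]
    have h6 : B / ε * (P i / |δ i|) * (C * P i) = C * (B * (P i ^ 2 / |δ i|)) / ε := by ring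
    rw [h6, one_le_div hε]
    exact h4

end Complexity

end

end AAE


theorem mainTheorem2 (C : ℝ) (hC : 0 < C) (δ₀ : ℝ) (hδ₀ : δ₀ < 1) :
    ∃ K : ℝ, 0 < K ∧
      ∀ (d : ℕ) [NeZero d] (J : ℕ) [NeZero J] (n : Fin J → ℕ) (β : ∀ j, Fin (n j) → ℝ)
        (μ : Fin J → ℕ) (ε δ' : ℝ),
        (∀ j, (∀ k, 0 ≤ β j k) ∨ (∀ k, β j k ≤ 0)) →
        (∀ j, ∃ k, β j k ≠ 0) →
        (∀ j, 1 ≤ μ j) →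
        0 < ε → 0 < δ' → δ' ≤ δ₀ →
        ∃ alg : AAE.QueryAlgorithm d n,
          ∀ (P : ∀ j, Fin (n j) → Matrix (Fin d) (Fin d) ℂ) (ψ : Fin d → ℂ)
            (O : AAE.Oracles d n) (δ : Fin J → ℝ),
            (∀ j k, IsStarProjection (P j k)) →
            O.Encodes ψ β P →
            (∀ j, |AAE.expVal ψ (AAE.groupOp β P j)| / AAE.sqrtSum (β j) ^ 2 =
              AAE.upperBound (μ j) + δ j) →
            (∀ j, δ j ∈ Set.Ico (-AAE.upperBound (μ j)) 0) →
            ε ≤ C * (AAE.normOneHalf β * ⨅ j, AAE.upperBound (μ j) ^ 2 / |δ j|) →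
            alg.failureProb O (AAE.expVal ψ (∑ j, AAE.groupOp β P j)) ε ≤ δ' ∧
            (alg.queries : ℝ) ≤
              K * ((∑ j, √(AAE.upperBound (μ j))) * AAE.normOneHalf β * Real.log (J / δ') / ε *
                ⨆ j, AAE.upperBound (μ j) / |δ j|) := by
  -- `δ₀` need not be positive; `δ₁` is, and it bounds `δ'` as well.
  set δ₁ := max δ₀ (1 / 2)
  have hδ₁ : δ₁ < 1 := max_lt hδ₀ (by norm_num)
  have hδ₁0 : 0 < δ₁ := lt_max_of_lt_right (by norm_num)
  have hlog : 0 < Real.log (1 / δ₁) := Real.log_pos (by rw [lt_div_iff₀ hδ₁0]; linarith)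
  have hlog2 : 0 < Real.log 2 := Real.log_pos one_lt_two
  set c := 1 / Real.log 2 + 1 / Real.log (1 / δ₁)
  refine ⟨524 * max C 1 * c, by positivity, ?_⟩
  intro d _ J _ n β μ ε δ' hβ hβ0 _ hε hδ' hδ'0
  set B := AAE.normOneHalf β with hBdef
  have hB : 0 < B := Finset.sum_pos (fun j _ => pow_pos (AAE.sqrtSum_pos (hβ0 j)) 2)
    Finset.univ_nonempty
  obtain ⟨i, hi⟩ := Finite.exists_min fun j => AAE.upperBound (μ j)
  have hP := fun j => AAE.upperBound_pos (μ j)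
  -- Every expectation value, divided by its norm, is estimated to precision `η`.
  set η := min (ε / B) (C * AAE.upperBound (μ i)) / max C 1 with hηdef
  have hC1 : 0 < max C 1 := lt_max_of_lt_right one_pos
  have hmin : 0 < min (ε / B) (C * AAE.upperBound (μ i)) :=
    lt_min (by positivity) (mul_pos hC (hP i))
  have hη : 0 < η := div_pos hmin hC1
  have hηP : ∀ j, η ≤ AAE.upperBound (μ j) := by
    intro j
    rw [hηdef, div_le_iff₀ hC1]
    refine (min_le_right _ _).trans ?_
    rw [mul_comm]
    exact mul_le_mul (hi j) (le_max_left _ _) hC.le (hP j).le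
  have hηε : B * η ≤ ε := by
    rw [← le_div_iff₀' hB]
    exact (div_le_self hmin.le (le_max_right _ _)).trans (min_le_left _ _)
  choose alg hq halg using fun j => AAE.exists_group_estimate (d := d) β j hη (hηP j)
    (AAE.upperBound_le_one _) hβ
  obtain ⟨hL, R, hR, hRL⟩ := AAE.exists_repetitions (J := J) hδ'
    (hδ'0.trans (le_max_left _ (1 / 2))) hδ₁
  obtain ⟨alg', hq', halg'⟩ := AAE.exists_linearCombination_estimate alg
    (fun j => AAE.groupSign (β j) * AAE.sqrtSum (β j) ^ 2) (η / 2) R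
  refine ⟨alg', fun P ψ O δ hPr hO hδ hδI hεC => ⟨?_, ?_⟩⟩
  · rw [AAE.expVal_sum_groupOp hPr hβ hβ0]
    refine (halg' O _ (fun j => halg j P ψ O hPr hO ?_) ε ?_).trans hR
    · rw [hδ]
      linarith [(hδI j).2]
    · simp only [abs_mul, AAE.abs_groupSign, one_mul, abs_pow, sq_abs]
      rw [mul_div_cancel₀ _ two_ne_zero]
      exact hηε
  · have h1 := AAE.inv_min_le hC hB hε hP hδI hεC i
    have h2 : η⁻¹ = max C 1 * (min (ε / B) (C * AAE.upperBound (μ i)))⁻¹ := by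
      rw [hηdef, inv_div, div_eq_mul_inv]
    have h3 : ∑ j, ((alg j).queries : ℝ) ≤
        524 * ((∑ j, √(AAE.upperBound (μ j))) * η⁻¹) := by
      rw [Finset.sum_mul, Finset.mul_sum]
      exact Finset.sum_le_sum fun j _ => hq j
    have h4 : 0 ≤ ∑ j, √(AAE.upperBound (μ j)) := Finset.sum_nonneg fun _ _ => Real.sqrt_nonneg _
    rw [hq']
    push_cast
    calc (R : ℝ) * ∑ j, ((alg j).queries : ℝ)
        ≤ (c * Real.log (J / δ')) * (524 * ((∑ j, √(AAE.upperBound (μ j))) * (max C 1 *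
            (B / ε * ⨆ j, AAE.upperBound (μ j) / |δ j|)))) := by
          refine mul_le_mul hRL (h3.trans ?_) (Finset.sum_nonneg fun _ _ => Nat.cast_nonneg _)
            (by positivity)
          rw [h2]
          gcongr
      _ = _ := by ring
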